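/- Theorem 10.1. Let $n,k\ge 1$ be integers. There exist a constant $K>0$ and a function $\rho:(0,\infty)\to(0,\infty)$ with $\lim_{\tau\to 0^+}\rho(\tau)=0$, both depending only on $n$ and $k$, with the following property. Let $B\subset\mathbb{R}^n$ be an open ball of positive radius centered at the origin, let $\mathcal{L}$ denote Lebesgue measure (on $\mathbb{R}^n$ or on $\mathbb{R}^{(k+1)n}$), and let $$\tilde B^{k+1}=\Big\{(x,h_1,\dots,h_k)\in(\mathbb{R}^n)^{k+1} : x\in B,\ h_i\in B \text{ for } 1\le i\le k,\ x+\sum_{i=1}^k\alpha_i h_i\in B \text{ for all } \alpha\in\{0,1\}^k\Big\}.$$ Let $\psi:B\to\mathbb{R}/\mathbb{Z}$ be Lebesgue measurable, let $\eta,\tau>0$, and write $\Delta_h f(x)=f(x+h)-f(x)$. Suppose that $$\mathcal{L}\big(\{(x,h_1,\dots,h_k)\in\tilde B^{k+1} : |e^{2\pi i\,\Delta_{h_1}\cdots\Delta_{h_k}\psi(x)}-1|>\tau\}\big)<\eta\,\mathcal{L}(\tilde B^{k+1}).$$ Then there exists a polynomial $P:\mathbb{R}^n\to\mathbb{R}$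 of degree at most $k-1$ such that $$\mathcal{L}\big(\{x\in B : |e^{2\pi i\psi(x)}e^{-2\pi iP(x)}-1|>\rho(\tau)\}\big)<K\eta\,\mathcal{L}(B).$$ -/

import Mathlib

open MeasureTheory Filter Topology

/-- The set `S̃^{k+1}` of all `(x, h) = (x, h₁, …, h_k)` such that `x`, every `h i` and every vertex
`x + ∑ i ∈ A, h i` of the parallelepiped based at `x` with sides `h i` lies in `S`.
The subset `A` of `Fin k` encodes the vector `α ∈ {0,1}^k` with support `A`. -/
def cubeSet {E : Type*} [AddCommGroup E] (S : Set E) (k : ℕ) : Set (E × (Fin k → E)) :=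
  {p | p.1 ∈ S ∧ (∀ i, p.2 i ∈ S) ∧ ∀ A : Finset (Fin k), p.1 + ∑ i ∈ A, p.2 i ∈ S}

/-- The iterated difference `Δ_{h₁} ⋯ Δ_{h_k} f`, where `Δ_h f (x) = f (x + h) - f x`. -/
def multiDiff {E G : Type*} [AddCommGroup E] [AddCommGroup G] :
    (k : ℕ) → (Fin k → E) → (E → G) → E → G
  | 0, _, f => f
  | k + 1, h, f => fwdDiff (h 0) (multiDiff k (Fin.tail h) f)

/-- The function `θ ↦ e^{2πiθ}` on `ℝ/ℤ`. -/
noncomputable def expCircle (θ : UnitAddCircle) : ℂ := (AddCircle.toCircle θ : ℂ)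

theorem expCircle_coe (t : ℝ) :
    expCircle (t : UnitAddCircle) = Complex.exp (2 * Real.pi * Complex.I * t) := by
  unfold expCircle
  rw [AddCircle.toCircle_apply_mk, Circle.coe_exp]
  push_cast
  congr 1
  ring

/-! This is a stability theorem of property-testing type, proved by self-correction followed by
Whitney's theorem. By scaling, `B` may be taken to be the unit ball. By L¹ approximation, `ψ` may be
replaced by a continuous `g`, which costs only a small set and a factor in `τ`. If `η` or `τ` is not
small, the conclusion is trivial with `P = 0`, so the measure of the bad cubes may be assumed
smaller than any constant depending on `n` and `k`.

Self-correction: at `x`, each cube based at `x` predicts `g x` from its other vertices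
(`vertexValue`). Two cubes differing in one edge give predictions that differ by one iterated
difference (`vertexValue_update`), so most small cubes at every point of a smaller ball agree, up to
`k τ`, on a value `φ x`. The identity `sum_vertexValue_eq` turns an iterated difference of
predictions into a combination of iterated differences of `g` over generic cubes. Hence `φ` has
iterated differences `O(τ)` over all small cubes, without exception.

Lifting: the average of `e^{2πi(prediction)}` over small cubes is continuous and does not vanish, so
it has a continuous argument. This places `φ` near a continuous real function, and a connectedness
argument lifts `φ` to a bounded real function with small differences (`exists_real_lift`).

Whitney: a bounded real function with small differences of order `k` is uniformly close to a
polynomial of degree at most `k - 1` (`exists_polynomial_near_of_hasSmallDiff`).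

Conclusion: on the smaller ball, `g` is close to `φ`, hence to `P`, except at base points of many
bad cubes, which Markov's inequality counts. Subtracting `P` leaves the bad cubes unchanged, and
cubes pointing towards the origin carry the estimate to the whole ball (`exists_measure_ball_le`).
-/

open scoped NNReal ENNReal

/-! ### Algebra of iterated differences. -/

section MultiDiff

variable {E G H : Type*} [AddCommGroup E] [AddCommGroup G] [AddCommGroup H]

theorem multiDiff_succ (k : ℕ) (h : Fin (k + 1) → E) (f : E → G) (x : E) :
    multiDiff (k + 1) h f x =
      multiDiff k (Fin.tail h) f (x + h 0) - multiDiff k (Fin.tail h) f x := rfl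

theorem multiDiff_cons (k : ℕ) (z : E) (h : Fin k → E) (f : E → G) (x : E) :
    multiDiff (k + 1) (Fin.cons z h) f x = multiDiff k h f (x + z) - multiDiff k h f x := by
  simp [multiDiff_succ]

theorem multiDiff_map (φ : G →+ H) (k : ℕ) (h : Fin k → E) (f : E → G) (x : E) :
    multiDiff k h (fun y => φ (f y)) x = φ (multiDiff k h f x) := by
  induction k generalizing x with
  | zero => rfl
  | succ k ih => simp [multiDiff_succ, ih]

theorem multiDiff_add (k : ℕ) (h : Fin k → E) (f g : E → G) (x : E) :
    multiDiff k h (fun y => f y + g y) x = multiDiff k h f x + multiDiff k h g x := by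
  induction k generalizing x with
  | zero => rfl
  | succ k ih => simp only [multiDiff_succ, ih]; abel

theorem multiDiff_sub (k : ℕ) (h : Fin k → E) (f g : E → G) (x : E) :
    multiDiff k h (fun y => f y - g y) x = multiDiff k h f x - multiDiff k h g x := by
  induction k generalizing x with
  | zero => rfl
  | succ k ih => simp only [multiDiff_succ, ih]; abel

theorem multiDiff_zero_fun (k : ℕ) (h : Fin k → E) (x : E) :
    multiDiff k h (fun _ => (0 : G)) x = 0 := by
  induction k generalizing x with
  | zero => rfl
  | succ k ih => simp [multiDiff_succ, ih]

theorem multiDiff_smul {R : Type*} [Ring R] [Module R G] (c : R) (k : ℕ) (h : Fin k → E)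
    (f : E → G) (x : E) : multiDiff k h (fun y => c • f y) x = c • multiDiff k h f x := by
  induction k generalizing x with
  | zero => rfl
  | succ k ih => simp only [multiDiff_succ, ih, smul_sub]

theorem multiDiff_sum {ι : Type*} (s : Finset ι) (k : ℕ) (h : Fin k → E)
    (f : ι → E → G) (x : E) :
    multiDiff k h (fun y => ∑ i ∈ s, f i y) x = ∑ i ∈ s, multiDiff k h (f i) x := by
  classical
  induction s using Finset.induction_on with
  | empty => simp [multiDiff_zero_fun]
  | insert i s hi ih => simp only [Finset.sum_insert hi, multiDiff_add, ih]

theorem multiDiff_comp_add_right (k : ℕ) (h : Fin k → E) (f : E → G) (x z : E) :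
    multiDiff k h (fun y => f (y + z)) x = multiDiff k h f (x + z) := by
  induction k generalizing x with
  | zero => rfl
  | succ k ih => simp only [multiDiff_succ, ih]; congr 2; abel

theorem multiDiff_comp_hom {E' : Type*} [AddCommGroup E'] (L : E' →+ E) (k : ℕ) (h : Fin k → E')
    (f : E → G) (x : E') :
    multiDiff k h (fun y => f (L y)) x = multiDiff k (fun i => L (h i)) f (L x) := by
  induction k generalizing x with
  | zero => rfl
  | succ k ih => simp only [multiDiff_succ, ih, map_add]; rfl

/-- The innermost difference of an iterated difference may be taken first. -/
theorem multiDiff_cons_eq_fwdDiff (k : ℕ) (z : E) (h : Fin k → E) (f : E → G) (x : E) :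
    multiDiff (k + 1) (Fin.cons z h) f x = multiDiff k h (fwdDiff z f) x := by
  rw [multiDiff_cons, ← multiDiff_comp_add_right, ← multiDiff_sub]
  rfl

/-- Two cubes glued along a common face. The shift `x + z` in the second term measures the failure
of additivity in an edge, which is a difference of one order higher. -/
theorem multiDiff_update_add (k : ℕ) (a : Fin k → E) (i : Fin k) (z z' : E) (f : E → G) (x : E) :
    multiDiff k (Function.update a i (z + z')) f x =
      multiDiff k (Function.update a i z) f x + multiDiff k (Function.update a i z') f (x + z) := by
  induction k generalizing x with
  | zero => exact i.elim0
  | succ k ih =>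
    refine Fin.cases ?_ (fun i => ?_) i
    · simp only [multiDiff_succ, Fin.tail_update_zero, Function.update_self, add_assoc]
      abel
    · simp only [multiDiff_succ, Fin.tail_update_succ, ih, ne_eq,
        (Fin.succ_ne_zero i).symm, not_false_eq_true, Function.update_of_ne, add_right_comm x]
      abel

theorem multiDiff_update_zero (k : ℕ) (a : Fin k → E) (i : Fin k) (f : E → G) (x : E) :
    multiDiff k (Function.update a i 0) f x = 0 := by
  have := multiDiff_update_add k a i 0 0 f x
  simpa using this

theorem sum_finset_fin_succ {M : Type*} [AddCommMonoid M] (k : ℕ)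
    (F : Finset (Fin (k + 1)) → M) :
    ∑ A, F A = ∑ A : Finset (Fin k), (F (A.map (Fin.succEmb k)) +
      F (insert 0 (A.map (Fin.succEmb k)))) := by
  classical
  have huniv : (Finset.univ : Finset (Finset (Fin (k + 1)))) =
      (insert 0 (Finset.univ.map (Fin.succEmb k))).powerset := by
    ext A
    simp only [Finset.mem_univ, Finset.mem_powerset, true_iff]
    intro i _
    refine Fin.cases (by simp) (fun j => by simp) i
  have h0 : (0 : Fin (k + 1)) ∉ (Finset.univ.map (Fin.succEmb k)) := by simp [Fin.succ_ne_zero]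
  have hmap : (Finset.univ.map (Fin.succEmb k)).powerset =
      Finset.univ.map (Finset.mapEmbedding (Fin.succEmb k)).toEmbedding := by
    ext A
    simp only [Finset.mem_powerset, Finset.mem_map, Finset.mem_univ, true_and,
      RelEmbedding.coe_toEmbedding, Finset.mapEmbedding_apply]
    rw [Finset.subset_map_iff]
    simp [eq_comm]
  rw [huniv, Finset.sum_powerset_insert h0, hmap]
  simp [Finset.sum_add_distrib]

theorem multiDiff_eq_sum (k : ℕ) (h : Fin k → E) (f : E → G) (x : E) :
    multiDiff k h f x =
      ∑ A : Finset (Fin k), (-1 : ℤ) ^ (k + A.card) • f (x + ∑ i ∈ A, h i) := by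
  induction k generalizing x with
  | zero =>
    rw [Fintype.sum_unique, Subsingleton.elim default (∅ : Finset (Fin 0))]
    simp [multiDiff]
  | succ k ih =>
    classical
    rw [multiDiff_succ, ih, ih, sum_finset_fin_succ, ← Finset.sum_sub_distrib]
    refine Finset.sum_congr rfl fun A _ => ?_
    have h0 : (0 : Fin (k + 1)) ∉ A.map (Fin.succEmb k) := by simp [Fin.succ_ne_zero]
    rw [Finset.sum_insert h0, Finset.card_insert_of_notMem h0]
    simp only [Finset.card_map, Finset.sum_map, Fin.coe_succEmb, Fin.tail, add_assoc]
    have h1 : (-1 : ℤ) ^ (k + (1 + A.card)) = -(-1) ^ (k + A.card) := by ring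
    have h2 : (-1 : ℤ) ^ (k + (1 + (A.card + 1))) = (-1) ^ (k + A.card) := by ring
    rw [h1, h2, neg_smul]
    abel

end MultiDiff

/-! ### Topology of the space of cubes. -/

section CubeSet

variable {E : Type*} [NormedAddCommGroup E]

theorem continuous_multiDiff {G : Type*} [AddCommGroup G] [TopologicalSpace G]
    [IsTopologicalAddGroup G] (k : ℕ) {f : E → G} (hf : Continuous f) :
    Continuous fun p : E × (Fin k → E) => multiDiff k p.2 f p.1 := by
  simp only [multiDiff_eq_sum]
  fun_prop

theorem isOpen_cubeSet {S : Set E} (hS : IsOpen S) (k : ℕ) : IsOpen (cubeSet S k) := by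
  have : cubeSet S k = (Prod.fst ⁻¹' S) ∩ ((⋂ i, (fun p : E × (Fin k → E) => p.2 i) ⁻¹' S) ∩
      ⋂ A : Finset (Fin k), (fun p : E × (Fin k → E) => p.1 + ∑ i ∈ A, p.2 i) ⁻¹' S) := by
    ext p
    simp [cubeSet]
  rw [this]
  refine (hS.preimage continuous_fst).inter ((isOpen_iInter_of_finite fun i => ?_).inter
    (isOpen_iInter_of_finite fun A => ?_))
  · exact hS.preimage (by fun_prop)
  · exact hS.preimage (by fun_prop)

end CubeSet

/-! ### Measure estimates for affine maps and fibres. -/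

/-- The preimage of `N` under a surjective affine map has, within a bounded set, measure at most a
constant times the measure of `N`, and the constant does not depend on the translation part. -/
theorem exists_measure_inter_preimage_le {W Y : Type*}
    [NormedAddCommGroup W] [NormedSpace ℝ W] [FiniteDimensional ℝ W] [MeasurableSpace W]
    [BorelSpace W] [NormedAddCommGroup Y] [NormedSpace ℝ Y] [FiniteDimensional ℝ Y]
    [MeasurableSpace Y] [BorelSpace Y] (μ : Measure W) [μ.IsAddHaarMeasure]
    (ν : Measure Y) [ν.IsAddHaarMeasure] (T : W →ₗ[ℝ] Y) (hT : Function.Surjective T)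
    {D : Set W} (hD : Bornology.IsBounded D) :
    ∃ C : ℝ≥0, ∀ (y₀ : Y) (N : Set Y), μ (D ∩ {w | y₀ + T w ∈ N}) ≤ C * ν N := by
  obtain ⟨S, hS⟩ := T.exists_rightInverse_of_surjective (LinearMap.range_eq_top.2 hT)
  have hTS : ∀ y, T (S y) = y := fun y => congrArg (fun f => f y) hS
  have hTc : Continuous T := T.continuous_of_finiteDimensional
  obtain ⟨r, hr⟩ := hD.subset_closedBall 0
  have hSc : Continuous S := S.continuous_of_finiteDimensional
  obtain ⟨r', hr'⟩ := ((isCompact_closedBall (0 : Y) 1).image hSc).isBounded.subset_closedBall 0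
  set D' : Set W := Metric.closedBall 0 (r + r') with hD'
  have hmem : ∀ w ∈ D, ∀ y ∈ Metric.ball (0 : Y) 1, w + S y ∈ D' := by
    intro w hw y hy
    have h1 := hr hw
    have h2 := hr' (Set.mem_image_of_mem S (Metric.ball_subset_closedBall hy))
    simp only [Metric.mem_closedBall, dist_zero_right, hD'] at *
    exact (norm_add_le _ _).trans (add_le_add h1 h2)
  have hD'top : μ D' ≠ ∞ := measure_closedBall_lt_top.ne
  have hb0 : ν (Metric.ball 0 1) ≠ 0 := (Metric.measure_ball_pos ν 0 one_pos).ne'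
  have hbtop : ν (Metric.ball 0 1) ≠ ∞ := measure_ball_lt_top.ne
  refine ⟨(μ D' / ν (Metric.ball 0 1)).toNNReal, fun y₀ N => ?_⟩
  rw [ENNReal.coe_toNNReal (ENNReal.div_ne_top hD'top hb0)]
  wlog hN : MeasurableSet N generalizing N
  · rw [← measure_toMeasurable N]
    refine le_trans (measure_mono ?_) (this _ (measurableSet_toMeasurable ν N))
    exact fun w hw => ⟨hw.1, subset_toMeasurable ν N hw.2⟩
  -- Translating by `S y` preserves `μ`, moves `T w` by `y` and stays in `D'`. Averaging over `y` in
  -- the unit ball and integrating in `y` first, each `w` in `D'` contributes at most `ν N`.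
  have key : ν (Metric.ball 0 1) * μ (D ∩ {w | y₀ + T w ∈ N}) ≤ μ D' * ν N := by
    calc ν (Metric.ball 0 1) * μ (D ∩ {w | y₀ + T w ∈ N})
        = ∫⁻ _ in Metric.ball (0 : Y) 1, μ (D ∩ {w | y₀ + T w ∈ N}) ∂ν := by
          rw [setLIntegral_const, mul_comm]
      _ ≤ ∫⁻ y in Metric.ball (0 : Y) 1, ∫⁻ w in D', N.indicator 1 (y₀ + T w - y) ∂μ ∂ν := by
          refine setLIntegral_mono_ae' measurableSet_ball (Eventually.of_forall fun y hy => ?_)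
          rw [← measure_preimage_add_right μ (-S y) (D ∩ {w | y₀ + T w ∈ N})]
          have hmeas : MeasurableSet {w : W | y₀ + T w - y ∈ N} :=
            ((continuous_const.add hTc).sub continuous_const).measurable hN
          have : (fun w => N.indicator (1 : Y → ℝ≥0∞) (y₀ + T w - y)) =
              Set.indicator {w : W | y₀ + T w - y ∈ N} 1 := by
            ext w; simp [Set.indicator]
          rw [this, lintegral_indicator_one hmeas, Measure.restrict_apply hmeas]
          refine measure_mono fun w hw => ?_
          simp only [Set.mem_preimage, Set.mem_inter_iff, Set.mem_ofPred_eq, map_add, map_neg,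
            hTS] at hw ⊢
          refine ⟨by rw [sub_eq_add_neg, add_assoc]; exact hw.2, ?_⟩
          have := hmem _ hw.1 y hy
          simpa using this
      _ ≤ ∫⁻ y, ∫⁻ w in D', N.indicator 1 (y₀ + T w - y) ∂μ ∂ν := setLIntegral_le_lintegral _ _
      _ = ∫⁻ w in D', ∫⁻ y, N.indicator 1 (y₀ + T w - y) ∂ν ∂μ := by
          refine lintegral_lintegral_swap ?_
          refine Measurable.aemeasurable ?_
          refine (measurable_one.indicator hN).comp ?_
          exact (((continuous_const.add (hTc.comp continuous_snd))).sub continuous_fst).measurable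
      _ = ∫⁻ _ in D', ν N ∂μ := by
          refine lintegral_congr fun w => ?_
          rw [lintegral_sub_left_eq_self (fun y => N.indicator (1 : Y → ℝ≥0∞) y),
            lintegral_indicator_one hN]
      _ = μ D' * ν N := by rw [setLIntegral_const, mul_comm]
  rw [ENNReal.div_eq_inv_mul, mul_assoc, ← ENNReal.mul_le_iff_le_inv hb0 hbtop]
  exact key

instance isAddHaarMeasure_volume_prod {E F : Type*}
    [NormedAddCommGroup E] [NormedSpace ℝ E] [FiniteDimensional ℝ E] [MeasureSpace E]
    [BorelSpace E] [(volume : Measure E).IsAddHaarMeasure]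
    [NormedAddCommGroup F] [NormedSpace ℝ F] [FiniteDimensional ℝ F] [MeasureSpace F]
    [BorelSpace F] [(volume : Measure F).IsAddHaarMeasure] :
    (volume : Measure (E × F)).IsAddHaarMeasure := by
  rw [Measure.volume_eq_prod]
  infer_instance

/-- A set of small measure in a product of a set `s` of positive measure with another space has a
fibre over a point of `s` of proportionally small measure. -/
theorem exists_measure_fiber_le {X Y : Type*} [MeasurableSpace X] [MeasurableSpace Y]
    (μ : Measure X) (ν : Measure Y) [SFinite μ] [SFinite ν] {s : Set Y} (hs0 : ν s ≠ 0)
    (hsfin : ν s ≠ ∞) {A : Set (X × Y)} (hA : MeasurableSet A) :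
    ∃ y ∈ s, μ {x | (x, y) ∈ A} ≤ (ν s)⁻¹ * μ.prod ν A := by
  obtain ⟨y, hy, h⟩ := exists_le_setLAverage (μ := ν) (s := s)
    (f := fun y => μ ((fun x => (x, y)) ⁻¹' A)) hs0 hsfin
    (measurable_measure_prodMk_right hA).aemeasurable
  refine ⟨y, hy, h.trans ?_⟩
  rw [setLAverage_eq, ENNReal.div_eq_inv_mul, Measure.prod_apply_symm hA]
  gcongr
  exact Measure.restrict_le_self

/-! ### Chordal distance on the circle. -/

/-- The chordal distance `|e^{2πiθ} - 1|` from `θ` to `0` on the circle `ℝ/ℤ`. -/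
noncomputable def chord (θ : UnitAddCircle) : ℝ := ‖expCircle θ - 1‖

section Chord

theorem expCircle_add (a b : UnitAddCircle) : expCircle (a + b) = expCircle a * expCircle b := by
  simp [expCircle, AddCircle.toCircle_add]

theorem norm_expCircle (a : UnitAddCircle) : ‖expCircle a‖ = 1 := by
  simp [expCircle, Circle.norm_coe]

theorem continuous_expCircle : Continuous expCircle :=
  continuous_subtype_val.comp AddCircle.continuous_toCircle

theorem continuous_chord : Continuous chord := (continuous_expCircle.sub continuous_const).norm

theorem chord_nonneg (a : UnitAddCircle) : 0 ≤ chord a := norm_nonneg _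

@[simp]
theorem chord_zero : chord 0 = 0 := by simp [chord, expCircle]

theorem chord_le_two (a : UnitAddCircle) : chord a ≤ 2 := by
  have := norm_sub_le (expCircle a) 1
  rw [norm_expCircle, norm_one] at this
  unfold chord
  linarith

theorem chord_sub_eq (a b : UnitAddCircle) : chord (a - b) = ‖expCircle a - expCircle b‖ := by
  have h : expCircle a - expCircle b = (expCircle (a - b) - 1) * expCircle b := by
    rw [sub_mul, ← expCircle_add, sub_add_cancel, one_mul]
  rw [h, norm_mul, norm_expCircle, mul_one, chord]

@[simp]
theorem chord_neg (a : UnitAddCircle) : chord (-a) = chord a := by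
  have h1 := chord_sub_eq 0 a
  have h2 := chord_sub_eq a 0
  rw [norm_sub_rev, ← h2] at h1
  simpa using h1

theorem chord_add_le (a b : UnitAddCircle) : chord (a + b) ≤ chord a + chord b := by
  have h : expCircle (a + b) - 1 = (expCircle a - 1) * expCircle b + (expCircle b - 1) := by
    rw [expCircle_add]; ring
  unfold chord
  rw [h]
  refine (norm_add_le _ _).trans ?_
  rw [norm_mul, norm_expCircle, mul_one]

theorem chord_sub_le (a b : UnitAddCircle) : chord (a - b) ≤ chord a + chord b := by
  rw [sub_eq_add_neg, ← chord_neg b]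
  exact chord_add_le _ _

theorem chord_sum_le {ι : Type*} (s : Finset ι) (f : ι → UnitAddCircle) :
    chord (∑ i ∈ s, f i) ≤ ∑ i ∈ s, chord (f i) := by
  classical
  induction s using Finset.induction_on with
  | empty => simp
  | insert i s hi ih =>
    rw [Finset.sum_insert hi, Finset.sum_insert hi]
    exact (chord_add_le _ _).trans (by gcongr)

theorem chord_sum_le_card_mul {ι : Type*} (s : Finset ι) (f : ι → UnitAddCircle) {c : ℝ}
    (h : ∀ i ∈ s, chord (f i) ≤ c) : chord (∑ i ∈ s, f i) ≤ s.card * c := by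
  refine (chord_sum_le s f).trans ((Finset.sum_le_sum h).trans_eq ?_)
  rw [Finset.sum_const, nsmul_eq_mul]

@[simp]
theorem chord_neg_one_pow_smul (m : ℕ) (a : UnitAddCircle) :
    chord ((-1 : ℤ) ^ m • a) = chord a := by
  rcases neg_one_pow_eq_or ℤ m with h | h <;> simp [h]

end Chord

/-! ### Predicting the value at a vertex from the rest of a cube. -/

section VertexValue

variable {E G : Type*} [AddCommGroup E] [AddCommGroup G]

/-- The value at `x` that the other vertices of the cube `(x, h)` predict for `g`: the value that
would make the iterated difference vanish. -/
def vertexValue (k : ℕ) (h : Fin k → E) (g : E → G) (x : E) : G :=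
  g x - (-1 : ℤ) ^ k • multiDiff k h g x

/-- The term of the empty set cancels `g x`, so the prediction is independent of the value being
predicted. -/
theorem vertexValue_eq_sum (k : ℕ) (h : Fin k → E) (g : E → G) (x : E) :
    vertexValue k h g x =
      -∑ B ∈ Finset.univ.erase (∅ : Finset (Fin k)),
        (-1 : ℤ) ^ B.card • g (x + ∑ i ∈ B, h i) := by
  classical
  have h2 : ((-1 : ℤ) ^ k * (-1) ^ k) = 1 := by rw [← mul_pow]; simp
  rw [vertexValue, multiDiff_eq_sum, Finset.smul_sum,
    ← Finset.add_sum_erase _ _ (Finset.mem_univ (∅ : Finset (Fin k)))]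
  simp only [smul_smul, pow_add, ← mul_assoc, h2, one_mul]
  simp

/-- The two cubes share the face through `x` transverse to direction `j`. Their other faces are
opposite faces of the cube based at `x + z` with `j`-th edge `h j - z`. -/
theorem vertexValue_update (k : ℕ) (h : Fin k → E) (j : Fin k) (z : E) (g : E → G) (x : E) :
    vertexValue k h g x - vertexValue k (Function.update h j z) g x =
      -((-1 : ℤ) ^ k • multiDiff k (Function.update h j (h j - z)) g (x + z)) := by
  have := multiDiff_update_add k h j z (h j - z) g x
  rw [add_sub_cancel, Function.update_eq_self] at this
  rw [vertexValue, vertexValue, this, smul_add]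
  abel

/-- The iterated difference of predicted values is a combination of iterated differences, when the
predictions are made from cubes that depend affinely on the vertex. -/
theorem sum_vertexValue_eq (k : ℕ) (a h : Fin k → E) (b : Fin k → Fin k → E) (g : E → G) (x : E) :
    ∑ A : Finset (Fin k), (-1 : ℤ) ^ (k + A.card) •
        vertexValue k (h + ∑ j ∈ A, b j) g (x + ∑ j ∈ A, a j) =
      -∑ B ∈ Finset.univ.erase (∅ : Finset (Fin k)), (-1 : ℤ) ^ B.card •
        multiDiff k (fun j => a j + ∑ i ∈ B, b j i) g (x + ∑ i ∈ B, h i) := by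
  simp only [vertexValue_eq_sum, multiDiff_eq_sum, smul_neg, Finset.smul_sum,
    Finset.sum_neg_distrib]
  -- For fixed nonempty `B`, the vertices labelled `B` of the predicting cubes form, as `A` varies,
  -- a cube based at `x + ∑ i ∈ B, h i` with edges `a j + ∑ i ∈ B, b j i`.
  rw [Finset.sum_comm]
  refine congrArg _ (Finset.sum_congr rfl fun B _ => Finset.sum_congr rfl fun A _ => ?_)
  rw [smul_comm]
  congr 3
  simp only [Pi.add_apply, Finset.sum_apply, Finset.sum_add_distrib]
  rw [Finset.sum_comm (s := A)]
  abel

end VertexValue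

theorem continuous_vertexValue {E G : Type*} [NormedAddCommGroup E] [AddCommGroup G]
    [TopologicalSpace G] [IsTopologicalAddGroup G] (k : ℕ) {g : E → G} (hg : Continuous g) :
    Continuous fun p : E × (Fin k → E) => vertexValue k p.2 g p.1 := by
  unfold vertexValue
  have := continuous_multiDiff k hg
  fun_prop

/-! ### Replacing the edges of a cube one at a time. -/

section Hybrid

variable {E : Type*}

/-- The tuple whose entries below `m` come from `h'` and the others from `h`. -/
def hybrid {k : ℕ} (h h' : Fin k → E) (m : ℕ) : Fin k → E :=
  fun i => if (i : ℕ) < m then h' i else h i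

theorem hybrid_succ {k : ℕ} (h h' : Fin k → E) (j : Fin k) :
    hybrid h h' (j + 1) = Function.update (hybrid h h' j) j (h' j) := by
  ext i
  by_cases hij : i = j
  · subst hij; simp [hybrid]
  · have : (i : ℕ) ≠ j := fun h => hij (Fin.ext h)
    simp only [hybrid, Function.update_of_ne hij]
    congr 1
    simp only [eq_iff_iff]
    omega

/-- Telescoping through the hybrids: each of the `k` steps changes a single edge and costs one
iterated difference by `vertexValue_update`. -/
theorem chord_vertexValue_sub_le [AddCommGroup E] {k : ℕ} {h h' : Fin k → E}
    {g : E → UnitAddCircle} {x : E} {τ : ℝ} (H : ∀ j : Fin k,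
      chord (multiDiff k (Function.update (hybrid h h' j) j (h j - h' j)) g (x + h' j)) ≤ τ) :
    chord (vertexValue k h g x - vertexValue k h' g x) ≤ k * τ := by
  have key : ∀ m : ℕ, m ≤ k →
      chord (vertexValue k h g x - vertexValue k (hybrid h h' m) g x) ≤ m * τ := by
    intro m
    induction m with
    | zero =>
      intro _
      have : hybrid h h' 0 = h := by ext i; simp [hybrid]
      simp [this]
    | succ m ih =>
      intro hm
      have h1 := ih (by omega)
      have h2 := vertexValue_update k (hybrid h h' m) ⟨m, hm⟩ (h' ⟨m, hm⟩) g x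
      have h3 := hybrid_succ h h' ⟨m, hm⟩
      simp only at h3
      rw [← h3] at h2
      have h4 : hybrid h h' m ⟨m, hm⟩ = h ⟨m, hm⟩ := by simp [hybrid]
      rw [h4] at h2
      have h5 := H ⟨m, hm⟩
      rw [← sub_add_sub_cancel _ (vertexValue k (hybrid h h' m) g x), h2]
      refine (chord_add_le _ _).trans ?_
      rw [chord_neg, chord_neg_one_pow_smul]
      push_cast
      linarith
  have : hybrid h h' k = h' := by ext i; simp [hybrid]
  have h1 := key k le_rfl
  rwa [this] at h1

end Hybrid

/-! ### Self-correction of a continuous circle-valued function. -/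

section SelfCorrection

variable {E : Type*} [NormedAddCommGroup E]

/-- The cubes in the unit ball over which the iterated difference of `g` is not small. -/
def badCubes (k : ℕ) (g : E → UnitAddCircle) (τ : ℝ) : Set (E × (Fin k → E)) :=
  {p ∈ cubeSet (Metric.ball 0 1) k | τ < chord (multiDiff k p.2 g p.1)}

theorem mem_cubeSet_ball {k : ℕ} {x : E} {h : Fin k → E} {θ r : ℝ} (hr : 0 ≤ r)
    (hx : ‖x‖ ≤ θ) (hh : ∀ i, ‖h i‖ ≤ r) (hθr : θ + k * r < 1) (hr1 : r < 1) :
    (x, h) ∈ cubeSet (Metric.ball (0 : E) 1) k := by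
  have hsum : ∀ A : Finset (Fin k), ‖x + ∑ i ∈ A, h i‖ < 1 := fun A => by
    have h1 : ‖∑ i ∈ A, h i‖ ≤ k * r := by
      refine (norm_sum_le_of_le A fun i _ => hh i).trans ?_
      rw [Finset.sum_const, nsmul_eq_mul]
      gcongr
      exact (Finset.card_le_univ A).trans_eq (Fintype.card_fin k)
    linarith [norm_add_le x (∑ i ∈ A, h i)]
  refine ⟨?_, fun i => ?_, fun A => ?_⟩
  · simpa using hsum ∅
  · simpa using (hh i).trans_lt hr1
  · simpa using hsum A

variable [NormedSpace ℝ E] [FiniteDimensional ℝ E]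
  [MeasureSpace E] [BorelSpace E] [SecondCountableTopology E]
  [(volume : Measure E).IsAddHaarMeasure]

/-- From every point of a smaller ball, most pairs of small cubes predict nearly equal values. -/
theorem exists_measure_vertexValue_pairs_le (k : ℕ) {θ r : ℝ} (hr : 0 < r)
    (hθr : (θ + r) + k * (2 * r) < 1) (hr1 : 2 * r < 1) :
    ∃ C : ℝ≥0, ∀ (g : E → UnitAddCircle) (τ : ℝ) (x : E), ‖x‖ ≤ θ →
      volume {w : (Fin k → E) × (Fin k → E) | w ∈ Metric.closedBall 0 r ∧
        k * τ < chord (vertexValue k w.1 g x - vertexValue k w.2 g x)} ≤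
          C * volume (badCubes k g τ) := by
  -- Up to the translation by `x`, this sends a pair of cubes to the cube responsible for the `j`-th
  -- hybrid step. Being onto, it pulls the bad cubes back to a small set, uniformly in `x`.
  let T : Fin k → ((Fin k → E) × (Fin k → E)) →ₗ[ℝ] (E × (Fin k → E)) := fun j =>
    { toFun := fun w => (w.2 j, Function.update (hybrid w.1 w.2 j) j (w.1 j - w.2 j))
      map_add' := fun w w' => by
        refine Prod.ext rfl (funext fun i => ?_)
        by_cases hi : i = j
        · subst hi; simp [add_sub_add_comm]
        · simp only [Prod.fst_add, Prod.snd_add, Pi.add_apply, Function.update_of_ne hi, hybrid]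
          split_ifs <;> rfl
      map_smul' := fun c w => by
        refine Prod.ext rfl (funext fun i => ?_)
        by_cases hi : i = j
        · subst hi; simp [smul_sub]
        · simp only [Prod.smul_fst, Prod.smul_snd, Pi.smul_apply, Function.update_of_ne hi, hybrid,
            RingHom.id_apply]
          split_ifs <;> rfl }
  have hT : ∀ j, Function.Surjective (T j) := by
    rintro j ⟨z, v⟩
    refine ⟨(Function.update v j (v j + z), Function.update v j z),
      Prod.ext ?_ (funext fun i => ?_)⟩
    · simp [T]
    · by_cases hi : i = j
      · subst hi; simp [T]
      · simp [T, Function.update_of_ne hi, hybrid]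
  have : (volume : Measure ((Fin k → E) × (Fin k → E))).IsAddHaarMeasure :=
    isAddHaarMeasure_volume_prod
  choose C hC using fun j => exists_measure_inter_preimage_le volume volume (T j) (hT j)
    (Metric.isBounded_closedBall (x := (0 : (Fin k → E) × (Fin k → E))) (r := r))
  refine ⟨∑ j, C j, fun g τ x hx => ?_⟩
  calc _ ≤ volume (⋃ j, Metric.closedBall 0 r ∩
          {w | (x, (0 : Fin k → E)) + T j w ∈ badCubes k g τ}) := by
        refine measure_mono fun w hw => ?_
        by_contra hcon
        refine hw.2.not_ge (chord_vertexValue_sub_le fun j => ?_)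
        simp only [Set.mem_iUnion, Set.mem_inter_iff, not_exists, not_and] at hcon
        have h1 := hcon j hw.1
        have hT' : (x, (0 : Fin k → E)) + T j w =
            (x + w.2 j, Function.update (hybrid w.1 w.2 j) j (w.1 j - w.2 j)) := by
          simp [T]
        simp only [Set.mem_ofPred_eq, hT', badCubes, not_and, not_lt] at h1
        have hw1 : ∀ i, ‖w.1 i‖ ≤ r := fun i => by
          have := mem_closedBall_zero_iff.1 hw.1
          exact (norm_le_pi_norm _ i).trans ((norm_fst_le w).trans this)
        have hw2 : ∀ i, ‖w.2 i‖ ≤ r := fun i => by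
          have := mem_closedBall_zero_iff.1 hw.1
          exact (norm_le_pi_norm _ i).trans ((norm_snd_le w).trans this)
        refine h1 (mem_cubeSet_ball (by linarith) ((norm_add_le _ _).trans
          (add_le_add hx (hw2 j))) (fun i => ?_) hθr hr1)
        by_cases hi : i = j
        · subst hi
          rw [Function.update_self]
          linarith [norm_sub_le (w.1 i) (w.2 i), hw1 i, hw2 i]
        · rw [Function.update_of_ne hi, hybrid]
          split_ifs
          · linarith [hw2 i]
          · linarith [hw1 i]
    _ ≤ ∑ j, C j * volume (badCubes k g τ) :=
        (measure_iUnion_fintype_le _ _).trans (Finset.sum_le_sum fun j _ => hC j _ _)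
    _ = _ := by rw [← Finset.sum_mul]; push_cast; rfl

/-- The corrected function: a value that most small cubes at a point predict. -/
theorem exists_corrected_function (k : ℕ) {θ r : ℝ} (hr : 0 < r)
    (hθr : (θ + r) + k * (2 * r) < 1) (hr1 : 2 * r < 1) :
    ∃ C : ℝ≥0, ∀ (g : E → UnitAddCircle), Continuous g → ∀ τ : ℝ, ∃ φ : E → UnitAddCircle,
      ∀ x : E, ‖x‖ ≤ θ →
        volume {h : Fin k → E | h ∈ Metric.closedBall 0 r ∧
          k * τ < chord (vertexValue k h g x - φ x)} ≤ C * volume (badCubes k g τ) := by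
  obtain ⟨C, hC⟩ := exists_measure_vertexValue_pairs_le (E := E) k hr hθr hr1
  have h0 : volume (Metric.closedBall (0 : Fin k → E) r) ≠ 0 :=
    (Metric.measure_closedBall_pos _ _ hr).ne'
  have htop : volume (Metric.closedBall (0 : Fin k → E) r) ≠ ∞ := measure_closedBall_lt_top.ne
  refine ⟨(volume (Metric.closedBall (0 : Fin k → E) r))⁻¹.toNNReal * C, fun g hg τ => ?_⟩
  have key : ∀ x : E, ∃ v : UnitAddCircle, ‖x‖ ≤ θ →
      volume {h : Fin k → E | h ∈ Metric.closedBall 0 r ∧ k * τ < chord (vertexValue k h g x - v)} ≤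
        ((volume (Metric.closedBall (0 : Fin k → E) r))⁻¹.toNNReal * C : ℝ≥0) *
          volume (badCubes k g τ) := by
    intro x
    by_cases hx : ‖x‖ ≤ θ
    swap
    · exact ⟨0, fun h => absurd h hx⟩
    have hc : Continuous fun h => vertexValue k h g x :=
      (continuous_vertexValue k hg).comp (continuous_const.prodMk continuous_id)
    -- By averaging, some cube `h'` disagrees with few others; its prediction serves as `φ x`. No
    -- regularity of `φ` in `x` is claimed.
    obtain ⟨h', hh', hle⟩ := exists_measure_fiber_le volume volume h0 htop
      (A := {w : (Fin k → E) × (Fin k → E) | w ∈ Metric.closedBall 0 r ∧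
        k * τ < chord (vertexValue k w.1 g x - vertexValue k w.2 g x)})
      (measurableSet_closedBall.inter (isOpen_lt continuous_const (continuous_chord.comp
        ((hc.comp continuous_fst).sub (hc.comp continuous_snd)))).measurableSet)
    refine ⟨vertexValue k h' g x, fun _ => ?_⟩
    rw [ENNReal.coe_mul, ENNReal.coe_toNNReal (ENNReal.inv_ne_top.2 h0), mul_assoc]
    refine le_trans (measure_mono fun h hh => ?_) (hle.trans ?_)
    · refine ⟨?_, hh.2⟩
      rw [mem_closedBall_zero_iff, Prod.norm_def, max_le_iff]
      exact ⟨mem_closedBall_zero_iff.1 hh.1, mem_closedBall_zero_iff.1 hh'⟩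
    · gcongr
      exact hC g τ x hx
  choose φ hφ using key
  exact ⟨φ, hφ⟩

/-- The corrected function has small iterated differences everywhere. -/
theorem exists_chord_multiDiff_corrected_le (k : ℕ) (hk : 1 ≤ k) {θ r σ : ℝ} (hr : 0 < r)
    (hθr : θ + 2 * k * ((k + 1) * r) < 1) (hr1 : σ + k * r < 1) (C : ℝ≥0) :
    ∃ δ : ℝ≥0∞, 0 < δ ∧ ∀ (g : E → UnitAddCircle) (τ : ℝ) (φ : E → UnitAddCircle),
      (∀ x : E, ‖x‖ ≤ θ → volume {h : Fin k → E | h ∈ Metric.closedBall 0 ((k + 1) * r) ∧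
          k * τ < chord (vertexValue k h g x - φ x)} ≤ C * volume (badCubes k g τ)) →
      volume (badCubes k g τ) ≤ δ → ∀ (x : E) (a : Fin k → E), (∀ i, ‖a i‖ ≤ σ) →
        (∀ A : Finset (Fin k), ‖x + ∑ i ∈ A, a i‖ ≤ θ) →
        chord (multiDiff k a φ x) ≤ 2 ^ k * (k + 1) * τ := by
  classical
  let S : Finset (Fin k) → ((Fin k → E) × (Fin k → Fin k → E)) →ₗ[ℝ] (Fin k → E) := fun A =>
    LinearMap.fst ℝ _ _ + (∑ j ∈ A, LinearMap.proj j) ∘ₗ LinearMap.snd ℝ _ _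
  have hSapp : ∀ A w, S A w = w.1 + ∑ j ∈ A, w.2 j := fun A w => by simp [S]
  have hS : ∀ A, Function.Surjective (S A) := fun A h => ⟨(h, 0), by simp [hSapp]⟩
  -- `S A` gives the edges of the cube predicting at vertex `A`, and `T B` is the variable part of
  -- the `B`-th cube in `sum_vertexValue_eq`. An index `i₀ ∈ B` suffices for surjectivity, whereas
  -- `T ∅` is zero.
  let T : Finset (Fin k) → ((Fin k → E) × (Fin k → Fin k → E)) →ₗ[ℝ] (E × (Fin k → E)) := fun B =>
    ((∑ i ∈ B, LinearMap.proj i) ∘ₗ LinearMap.fst ℝ _ _).prod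
      (LinearMap.pi fun j => (∑ i ∈ B, LinearMap.proj i) ∘ₗ LinearMap.proj j ∘ₗ
        LinearMap.snd ℝ _ _)
  have hTapp : ∀ B w, T B w = (∑ i ∈ B, w.1 i, fun j => ∑ i ∈ B, w.2 j i) := fun B w => by
    ext <;> simp [T]
  have hT : ∀ B : Finset (Fin k), B ≠ ∅ → Function.Surjective (T B) := by
    rintro B hB ⟨z, v⟩
    obtain ⟨i₀, hi₀⟩ := Finset.nonempty_iff_ne_empty.2 hB
    refine ⟨(Pi.single i₀ z, fun j => Pi.single i₀ (v j)), ?_⟩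
    rw [hTapp]
    simp [hi₀]
  set D : Set ((Fin k → E) × (Fin k → Fin k → E)) := Metric.closedBall 0 r with hD
  have hDb : Bornology.IsBounded D := Metric.isBounded_closedBall
  have : (volume : Measure (Fin k → Fin k → E)).IsAddHaarMeasure :=
    Measure.pi.isAddHaarMeasure _
  have : (volume : Measure ((Fin k → E) × (Fin k → Fin k → E))).IsAddHaarMeasure :=
    isAddHaarMeasure_volume_prod
  choose C₁ hC₁ using fun A => exists_measure_inter_preimage_le volume volume (S A) (hS A) hDb
  have hT' : ∀ B : Finset (Fin k), ∃ C₂ : ℝ≥0, B ≠ ∅ → ∀ (y₀ : E × (Fin k → E)) N,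
      volume (D ∩ {w | y₀ + T B w ∈ N}) ≤ C₂ * volume N := fun B => by
    by_cases hB : B = ∅
    · exact ⟨0, fun h => absurd hB h⟩
    · obtain ⟨C₂, h⟩ := exists_measure_inter_preimage_le volume volume (T B) (hT B hB) hDb
      exact ⟨C₂, fun _ => h⟩
  choose C₂ hC₂ using hT'
  set M : ℝ≥0 := ∑ A, (C₁ A * C) + ∑ B, C₂ B with hM
  have hDpos : 0 < volume D := Metric.measure_closedBall_pos _ _ hr
  -- With this `δ` the exceptional sets fill at most half of `D`, so some `w` avoids them all. The
  -- `+ 1` keeps the denominator nonzero.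
  refine ⟨volume D / 2 / (M + 1), ?_, fun g τ φ hφ hN x a ha hxa => ?_⟩
  · refine ENNReal.div_pos (ENNReal.half_pos hDpos.ne').ne' (by simp)
  have hDtop : volume D ≠ ∞ := measure_closedBall_lt_top.ne
  let bad : E → Set (Fin k → E) := fun y => {h : Fin k → E | h ∈ Metric.closedBall 0 ((k + 1) * r) ∧
          k * τ < chord (vertexValue k h g y - φ y)}
  obtain ⟨w, hwD, hw⟩ : ∃ w ∈ D,
      w ∉ (⋃ A : Finset (Fin k), D ∩ {w | 0 + S A w ∈ bad (x + ∑ i ∈ A, a i)}) ∪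
      ⋃ B ∈ Finset.univ.erase (∅ : Finset (Fin k)), D ∩ {w | (x, a) + T B w ∈ badCubes k g τ} := by
    by_contra! hcon
    have h1 : volume D ≤ M * volume (badCubes k g τ) := by
      refine (measure_mono hcon).trans ((measure_union_le _ _).trans ?_)
      rw [hM, ENNReal.coe_add, add_mul, ENNReal.ofNNReal_finsetSum, ENNReal.ofNNReal_finsetSum,
        Finset.sum_mul, Finset.sum_mul]
      refine add_le_add ((measure_iUnion_fintype_le _ _).trans (Finset.sum_le_sum fun A _ => ?_))
        ((measure_biUnion_finset_le _ _).trans ?_)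
      · refine (hC₁ A _ _).trans ?_
        rw [ENNReal.coe_mul, mul_assoc]
        gcongr
        exact hφ _ (hxa A)
      · refine (Finset.sum_le_sum fun B hB => hC₂ B (Finset.ne_of_mem_erase hB) _ _).trans ?_
        exact Finset.sum_le_sum_of_subset (Finset.erase_subset _ _)
    have h2 : volume D ≤ volume D / 2 := by
      calc volume D ≤ M * volume (badCubes k g τ) := h1
        _ ≤ (M + 1) * (volume D / 2 / (M + 1)) := by gcongr; exact le_self_add
        _ = volume D / 2 := ENNReal.mul_div_cancel (by simp) (by finiteness)
    exact (ENNReal.half_lt_self hDpos.ne' hDtop).not_ge h2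
  simp only [Set.mem_union, Set.mem_iUnion, Set.mem_inter_iff, Set.mem_ofPred_eq, not_or,
    not_exists, not_and, hSapp, hTapp, zero_add] at hw
  obtain ⟨hwS, hwT⟩ := hw
  have hn := mem_closedBall_zero_iff.1 hwD
  have hw1 : ∀ i, ‖w.1 i‖ ≤ r := fun i => (norm_le_pi_norm _ i).trans ((norm_fst_le w).trans hn)
  have hw2' : ∀ j, ‖w.2 j‖ ≤ r := fun j => (norm_le_pi_norm _ j).trans ((norm_snd_le w).trans hn)
  have hw2 : ∀ j i, ‖w.2 j i‖ ≤ r := fun j i => (norm_le_pi_norm _ i).trans (hw2' j)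
  have hcard : ∀ A : Finset (Fin k), A.card ≤ k := fun A =>
    (Finset.card_le_univ A).trans_eq (Fintype.card_fin k)
  have hsum : ∀ (F : Type _) [NormedAddCommGroup F] (A : Finset (Fin k)) (f : Fin k → F),
      (∀ i, ‖f i‖ ≤ r) → ‖∑ i ∈ A, f i‖ ≤ k * r := fun F _ A f hf => by
    refine (norm_sum_le_of_le A fun i _ => hf i).trans ?_
    rw [Finset.sum_const, nsmul_eq_mul]
    gcongr
    exact hcard A
  have hgoodS : ∀ A : Finset (Fin k), chord (vertexValue k (w.1 + ∑ j ∈ A, w.2 j) g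
      (x + ∑ i ∈ A, a i) - φ (x + ∑ i ∈ A, a i)) ≤ k * τ := fun A => by
    by_contra! hlt
    -- At most `k` vectors of size `r` are added to `w.1`, which explains the radius `(k + 1) * r`.
    refine hwS A hwD ⟨?_, hlt⟩
    rw [mem_closedBall_zero_iff]
    have := hsum _ A _ hw2'
    have h3 : ‖w.1‖ ≤ r := (norm_fst_le w).trans hn
    linarith [norm_add_le w.1 (∑ j ∈ A, w.2 j)]
  have hgoodT : ∀ B ∈ Finset.univ.erase (∅ : Finset (Fin k)),
      chord (multiDiff k (fun j => a j + ∑ i ∈ B, w.2 j i) g (x + ∑ i ∈ B, w.1 i)) ≤ τ := by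
    intro B hB
    by_contra! hlt
    refine hwT B hB hwD ⟨⟨?_, fun i => ?_, fun A => ?_⟩, hlt⟩
    all_goals simp only [Prod.fst_add, Prod.snd_add, Pi.add_apply, mem_ball_zero_iff,
      Finset.sum_add_distrib]
    · have h1 := hxa ∅
      have h2 := hsum _ B _ hw1
      simp only [Finset.sum_empty, add_zero] at h1
      have h3 : 0 ≤ (k : ℝ) * (k * r) := by positivity
      nlinarith [norm_add_le x (∑ i ∈ B, w.1 i), norm_nonneg (∑ i ∈ B, w.1 i)]
    · linarith [norm_add_le (a i) (∑ l ∈ B, w.2 i l), ha i, hsum _ B _ (hw2 i)]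
    · have h1 := hxa A
      have h2 := hsum _ B _ hw1
      have h3 : ‖∑ j ∈ A, ∑ i ∈ B, w.2 j i‖ ≤ k * (k * r) := by
        refine (norm_sum_le_of_le A fun i _ => hsum _ B _ (hw2 i)).trans ?_
        rw [Finset.sum_const, nsmul_eq_mul]
        gcongr
        exact hcard A
      have h4 : x + ∑ i ∈ B, w.1 i + (∑ i ∈ A, a i + ∑ j ∈ A, ∑ i ∈ B, w.2 j i) =
        (x + ∑ i ∈ A, a i) + ∑ i ∈ B, w.1 i + ∑ j ∈ A, ∑ i ∈ B, w.2 j i := by abel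
      rw [h4]
      have h5 : 0 ≤ (k : ℝ) * (k * r) := by positivity
      have h6 : 0 ≤ (k : ℝ) * r := by positivity
      have h7 := norm_add₃_le (a := x + ∑ i ∈ A, a i) (b := ∑ i ∈ B, w.1 i)
        (c := ∑ j ∈ A, ∑ i ∈ B, w.2 j i)
      nlinarith
  -- As `k ≥ 1`, a nonempty `B` exists and forces this sign. The final bound `2 ^ k * (k * τ) + (2 ^
  -- k - 1) * τ` needs it to be absorbed into `2 ^ k * (k + 1) * τ`.
  have hτ : 0 ≤ τ := by
    have : Nonempty (Fin k) := ⟨⟨0, hk⟩⟩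
    exact (chord_nonneg _).trans (hgoodT Finset.univ
      (Finset.mem_erase.2 ⟨Finset.univ_nonempty.ne_empty, Finset.mem_univ _⟩))
  have hid := sum_vertexValue_eq k a w.1 w.2 g x
  rw [multiDiff_eq_sum]
  have heq : ∑ A : Finset (Fin k), (-1 : ℤ) ^ (k + A.card) • φ (x + ∑ i ∈ A, a i) =
      (∑ A : Finset (Fin k), (-1 : ℤ) ^ (k + A.card) •
        vertexValue k (w.1 + ∑ j ∈ A, w.2 j) g (x + ∑ j ∈ A, a j)) -
      ∑ A : Finset (Fin k), (-1 : ℤ) ^ (k + A.card) •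
        (vertexValue k (w.1 + ∑ j ∈ A, w.2 j) g (x + ∑ j ∈ A, a j) - φ (x + ∑ i ∈ A, a i)) := by
    rw [← Finset.sum_sub_distrib]
    exact Finset.sum_congr rfl fun A _ => by rw [← smul_sub, sub_sub_cancel]
  rw [heq, hid]
  refine (chord_sub_le _ _).trans ?_
  rw [chord_neg]
  have e1 := chord_sum_le_card_mul (Finset.univ.erase (∅ : Finset (Fin k))) (fun B =>
    (-1 : ℤ) ^ B.card • multiDiff k (fun j => a j + ∑ i ∈ B, w.2 j i) g (x + ∑ i ∈ B, w.1 i))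
    fun B hB => (chord_neg_one_pow_smul _ _).trans_le (hgoodT B hB)
  have e2 := chord_sum_le_card_mul (Finset.univ : Finset (Finset (Fin k))) (fun A =>
    (-1 : ℤ) ^ (k + A.card) •
      (vertexValue k (w.1 + ∑ j ∈ A, w.2 j) g (x + ∑ j ∈ A, a j) - φ (x + ∑ i ∈ A, a i)))
    fun A _ => (chord_neg_one_pow_smul _ _).trans_le (hgoodS A)
  rw [Finset.card_univ, Fintype.card_finset, Fintype.card_fin] at e2
  push_cast at e2
  rw [Finset.card_erase_of_mem (Finset.mem_univ _), Finset.card_univ, Fintype.card_finset,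
    Fintype.card_fin, Nat.cast_sub Nat.one_le_two_pow] at e1
  push_cast at e1
  linarith

end SelfCorrection

/-! ### Chordal distance against absolute value, and continuous arguments. -/

section ChordReal

theorem chord_coe (t : ℝ) : chord (t : UnitAddCircle) = 2 * |Real.sin (Real.pi * t)| := by
  have h : (2 * Real.pi * Complex.I * t : ℂ) = Complex.I * ((2 * Real.pi * t : ℝ) : ℂ) := by
    push_cast; ring
  rw [chord, expCircle_coe, h, Complex.norm_exp_I_mul_ofReal_sub_one, norm_mul, Real.norm_ofNat,
    Real.norm_eq_abs]
  congr 3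
  ring

/-- Jordan's inequality `2 |u| / π ≤ |sin u|` for `|u| ≤ π / 2`. -/
theorem four_mul_abs_le_chord {t : ℝ} (ht : |t| ≤ 1 / 2) : 4 * |t| ≤ chord (t : UnitAddCircle) := by
  have h1 : |Real.pi * t| ≤ Real.pi / 2 := by
    rw [abs_mul, abs_of_pos Real.pi_pos]
    nlinarith [Real.pi_pos]
  have h2 := Real.mul_abs_le_abs_sin h1
  rw [abs_mul, abs_of_pos Real.pi_pos, ← mul_assoc, div_mul_cancel₀ _ Real.pi_ne_zero] at h2
  rw [chord_coe]
  linarith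

theorem chord_coe_le (t : ℝ) : chord (t : UnitAddCircle) ≤ 2 * Real.pi * |t| := by
  have h := Real.abs_sin_le_abs (x := Real.pi * t)
  rw [abs_mul, abs_of_pos Real.pi_pos] at h
  rw [chord_coe]
  linarith

theorem exists_coe_eq_abs_le_half (a : UnitAddCircle) :
    ∃ s : ℝ, (s : UnitAddCircle) = a ∧ |s| ≤ 1 / 2 := by
  obtain ⟨t, rfl⟩ := QuotientAddGroup.mk_surjective a
  refine ⟨t - round t, ?_, abs_sub_round t⟩
  refine (QuotientAddGroup.eq_iff_sub_mem.2 ?_)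
  rw [sub_sub_cancel_left, AddSubgroup.mem_zmultiples_iff]
  exact ⟨-round t, by simp⟩

end ChordReal

/-- A continuous function from a real normed space to the plane which does not vanish on a ball has
a continuous argument there. -/
theorem exists_continuous_angle {E : Type*} [NormedAddCommGroup E] [NormedSpace ℝ E] {θ : ℝ}
    (hθ : 0 < θ) {F : E → ℂ} (hF : Continuous F) (hF0 : ∀ x, ‖x‖ ≤ θ → F x ≠ 0) :
    ∃ Φ : E → ℝ, Continuous Φ ∧
      ∀ x, ‖x‖ ≤ θ → F x = ‖F x‖ * expCircle (Φ x : UnitAddCircle) := by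
  -- Radial retraction onto the closed ball: composing with it makes the unit-circle-valued map
  -- defined on all of `E`, where it lifts through the covering `Circle.exp`.
  let ρ : E → E := fun x => (θ / max θ ‖x‖) • x
  have hmax : ∀ x : E, 0 < max θ ‖x‖ := fun x => lt_max_of_lt_left hθ
  have hρc : Continuous ρ :=
    (continuous_const.div (continuous_const.max continuous_norm) fun x => (hmax x).ne').smul
      continuous_id
  have hρn : ∀ x, ‖ρ x‖ ≤ θ := fun x => by
    simp only [ρ]
    rw [norm_smul, Real.norm_of_nonneg (div_nonneg hθ.le (hmax x).le), div_mul_eq_mul_div,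
      div_le_iff₀ (hmax x)]
    gcongr
    exact le_max_right _ _
  have hρid : ∀ x, ‖x‖ ≤ θ → ρ x = x := fun x hx => by
    simp only [ρ]
    rw [max_eq_left hx, div_self hθ.ne', one_smul]
  have hG1 : ∀ x, F (ρ x) / ‖F (ρ x)‖ ∈ Submonoid.unitSphere ℂ := fun x => by
    have : ‖F (ρ x)‖ ≠ 0 := norm_ne_zero_iff.2 (hF0 _ (hρn x))
    refine mem_sphere_zero_iff_norm.2 ?_
    rw [norm_div, Complex.norm_real, norm_norm, div_self this]
  let G : C(E, Circle) := ⟨fun x => ⟨F (ρ x) / ‖F (ρ x)‖, hG1 x⟩, by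
    refine Continuous.subtype_mk ((hF.comp hρc).div
      (Complex.continuous_ofReal.comp (hF.comp hρc).norm) fun x => ?_) _
    exact Complex.ofReal_ne_zero.2 (norm_ne_zero_iff.2 (hF0 _ (hρn x)))⟩
  obtain ⟨t₀, ht₀⟩ : ∃ t₀ : ℝ, Circle.exp t₀ = G 0 := ⟨_, Circle.exp_arg (G 0)⟩
  obtain ⟨Ψ, ⟨-, hΨ⟩, -⟩ := Circle.isCoveringMap_exp.existsUnique_continuousMap_lifts G 0 t₀ ht₀
  refine ⟨fun x => Ψ x / (2 * Real.pi), by fun_prop, fun x hx => ?_⟩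
  have h1 : expCircle ((Ψ x / (2 * Real.pi) : ℝ) : UnitAddCircle) = F x / ‖F x‖ := by
    have h2 : Circle.exp (Ψ x) = G x := congrFun hΨ x
    have h3 : ((G x : Circle) : ℂ) = F (ρ x) / ‖F (ρ x)‖ := rfl
    rw [hρid x hx, ← h2] at h3
    rw [← h3, expCircle_coe, Circle.coe_exp]
    congr 1
    push_cast
    field_simp
  rw [h1, mul_div_cancel₀]
  exact Complex.ofReal_ne_zero.2 (norm_ne_zero_iff.2 (hF0 _ hx))

theorem abs_multiDiff_le {E : Type*} [AddCommGroup E] (k : ℕ) (a : Fin k → E) (f : E → ℝ)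
    (x : E) {c : ℝ} (hc : ∀ A : Finset (Fin k), |f (x + ∑ i ∈ A, a i)| ≤ c) :
    |multiDiff k a f x| ≤ 2 ^ k * c := by
  rw [multiDiff_eq_sum]
  refine (Finset.abs_sum_le_sum_abs _ _).trans ((Finset.sum_le_sum fun A _ => ?_).trans_eq
    (b := ∑ _A : Finset (Fin k), c) ?_)
  · rw [zsmul_eq_mul, abs_mul]
    simpa using hc A
  · simp

/-! ### Lifting the corrected function to real values. -/

section RealLift

variable {E : Type*} [NormedAddCommGroup E] [NormedSpace ℝ E]

/-- A function on the circle which most small cubes at each point of a ball predict is uniformly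
close to a continuous function with real values. -/
theorem exists_continuous_chord_le [FiniteDimensional ℝ E]
    [MeasureSpace E] [BorelSpace E] [SecondCountableTopology E]
    [(volume : Measure E).IsAddHaarMeasure] (k : ℕ) {θ r κ : ℝ} (hθ : 0 < θ) (hr : 0 < r)
    (hκ : 0 < κ) (hκ1 : κ ≤ 1) (C : ℝ≥0) :
    ∃ δ : ℝ≥0∞, 0 < δ ∧ ∀ (g : E → UnitAddCircle), Continuous g →
      ∀ (τ : ℝ) (φ : E → UnitAddCircle), k * τ ≤ κ / 4 →
      (∀ x : E, ‖x‖ ≤ θ → volume {h : Fin k → E | h ∈ Metric.closedBall 0 r ∧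
          k * τ < chord (vertexValue k h g x - φ x)} ≤ C * volume (badCubes k g τ)) →
      volume (badCubes k g τ) ≤ δ → ∃ Φ : E → ℝ, Continuous Φ ∧
        ∀ x, ‖x‖ ≤ θ → chord (φ x - (Φ x : UnitAddCircle)) ≤ κ := by
  set D : Set (Fin k → E) := Metric.closedBall 0 r with hD
  have hDpos : 0 < volume D := Metric.measure_closedBall_pos _ _ hr
  have hDtop : volume D ≠ ∞ := measure_closedBall_lt_top.ne
  have hm : 0 < volume.real D := ENNReal.toReal_pos hDpos.ne' hDtop
  -- Wrong predictions occupy at most a fraction `κ / 8` of `D`. As `chord ≤ 2` they contribute `κ /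
  -- 4` to the average, and the correct ones contribute another `κ / 4`.
  refine ⟨volume D * ENNReal.ofReal (κ / 8) / (C + 1), ?_, fun g hg τ φ hτ hφ hN => ?_⟩
  · refine ENNReal.div_pos (mul_ne_zero hDpos.ne' ?_) (by simp)
    simpa using hκ
  have hVc : Continuous fun p : E × (Fin k → E) => expCircle (vertexValue k p.2 g p.1) :=
    continuous_expCircle.comp (continuous_vertexValue k hg)
  set F : E → ℂ := fun x => ∫ h in D, expCircle (vertexValue k h g x) with hF
  have hFc : Continuous F := continuous_parametric_integral_of_continuous
    (f := fun x h => expCircle (vertexValue k h g x)) hVc (isCompact_closedBall _ _)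
  have hclose : ∀ x, ‖x‖ ≤ θ →
      ‖F x - volume.real D * expCircle (φ x)‖ ≤ volume.real D * (κ / 2) := by
    intro x hx
    have hc : Continuous fun h => vertexValue k h g x :=
      (continuous_vertexValue k hg).comp (continuous_const.prodMk continuous_id)
    have hec := continuous_expCircle.comp hc
    have hfin : IsFiniteMeasure (volume.restrict D) := isFiniteMeasure_restrict.2 hDtop
    set A : Set (Fin k → E) := {h | k * τ < chord (vertexValue k h g x - φ x)} with hA
    have hAm : MeasurableSet A :=
      (isOpen_lt continuous_const (continuous_chord.comp (hc.sub continuous_const))).measurableSet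
    have hAle : (volume.restrict D).real A ≤ volume.real D * (κ / 8) := by
      rw [measureReal_restrict_apply hAm, measureReal_def]
      refine ENNReal.toReal_le_of_le_ofReal (by positivity) ?_
      rw [ENNReal.ofReal_mul measureReal_nonneg, ofReal_measureReal hDtop]
      calc volume (A ∩ D) ≤ C * volume (badCubes k g τ) :=
            (measure_mono (by rw [Set.inter_comm]; exact subset_rfl)).trans (hφ x hx)
        _ ≤ (C + 1) * (volume D * ENNReal.ofReal (κ / 8) / (C + 1)) := by
            gcongr; exact le_self_add
        _ = _ := ENNReal.mul_div_cancel (by simp) (by finiteness)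
    have h1 : F x - volume.real D * expCircle (φ x) =
        ∫ h in D, (expCircle (vertexValue k h g x) - expCircle (φ x)) := by
      rw [integral_sub, setIntegral_const, hF, Complex.real_smul]
      · exact (hec.continuousOn.integrableOn_compact (isCompact_closedBall _ _))
      · exact integrable_const _
    rw [h1]
    calc ‖∫ h in D, (expCircle (vertexValue k h g x) - expCircle (φ x))‖
        ≤ ∫ h in D, (κ / 4 + A.indicator (fun _ => (2 : ℝ)) h) := by
          refine norm_integral_le_of_norm_le ?_ (Eventually.of_forall fun h => ?_)
          · exact (integrable_const _).add ((integrable_const _).indicator hAm)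
          · rw [← chord_sub_eq]
            by_cases hh : h ∈ A
            · rw [Set.indicator_of_mem hh]
              linarith [chord_le_two (vertexValue k h g x - φ x)]
            · rw [Set.indicator_of_notMem hh]
              have : chord (vertexValue k h g x - φ x) ≤ k * τ := not_lt.1 hh
              linarith
      _ = volume.real D * (κ / 4) + 2 * (volume.restrict D).real A := by
          rw [integral_add (integrable_const _) ((integrable_const _).indicator hAm),
            setIntegral_const, integral_indicator_const _ hAm]
          simp [mul_comm]
      _ ≤ _ := by linarith
  have hF0 : ∀ x, ‖x‖ ≤ θ → F x ≠ 0 := by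
    intro x hx h0
    have := hclose x hx
    rw [h0, zero_sub, norm_neg, norm_mul, norm_expCircle, Complex.norm_real,
      Real.norm_of_nonneg hm.le] at this
    nlinarith
  obtain ⟨Φ, hΦc, hΦ⟩ := exists_continuous_angle hθ hFc hF0
  refine ⟨Φ, hΦc, fun x hx => ?_⟩
  have h1 := hclose x hx
  have h2 : |‖F x‖ - volume.real D| ≤ volume.real D * (κ / 2) := by
    have h3 : ‖(volume.real D : ℂ) * expCircle (φ x)‖ = volume.real D := by
      rw [norm_mul, norm_expCircle, Complex.norm_real, Real.norm_of_nonneg hm.le, mul_one]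
    have := abs_norm_sub_norm_le (F x) (volume.real D * expCircle (φ x))
    rw [h3] at this
    exact this.trans h1
  have h4 : volume.real D * chord (φ x - (Φ x : UnitAddCircle)) ≤ volume.real D * κ := by
    -- The distance of `F x` from `volume.real D * expCircle (φ x)` and the error in the modulus of
    -- `F x` each cost half of `κ`.
    have h5 : (volume.real D : ℂ) * (expCircle (φ x) - expCircle (Φ x : UnitAddCircle)) =
        -(F x - volume.real D * expCircle (φ x)) +
          ((‖F x‖ - volume.real D : ℝ) : ℂ) * expCircle (Φ x : UnitAddCircle) := by
      conv_rhs => rw [hΦ x hx]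
      rw [norm_mul, norm_expCircle]
      simp
      ring
    rw [chord_sub_eq]
    have h6 : ‖(volume.real D : ℂ) * (expCircle (φ x) - expCircle (Φ x : UnitAddCircle))‖ =
        volume.real D * ‖expCircle (φ x) - expCircle (Φ x : UnitAddCircle)‖ := by
      rw [norm_mul, Complex.norm_real, Real.norm_of_nonneg hm.le]
    rw [← h6, h5]
    refine (norm_add_le _ _).trans ?_
    rw [norm_neg, norm_mul, norm_expCircle, Complex.norm_real, Real.norm_eq_abs]
    linarith
  exact le_of_mul_le_mul_left h4 hm

/-- A function on the circle with small iterated differences on a ball which is close to a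
continuous real-valued function lifts to a real-valued function with small iterated differences. -/
theorem exists_real_lift (k : ℕ) (hk : 1 ≤ k) {θ σ ε : ℝ} (hε : ε ≤ 1 / 2)
    {φ : E → UnitAddCircle} {Φ₀ : E → ℝ} (hΦ₀ : Continuous Φ₀)
    (hφ : ∀ x, ‖x‖ ≤ θ → chord (φ x - (Φ₀ x : UnitAddCircle)) ≤ (1 / 2) ^ k / 4)
    (hdiff : ∀ (x : E) (a : Fin k → E), (∀ i, ‖a i‖ ≤ σ) →
        (∀ A : Finset (Fin k), ‖x + ∑ i ∈ A, a i‖ ≤ θ) → chord (multiDiff k a φ x) ≤ ε) :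
    ∃ Φ : E → ℝ, (∀ x, |Φ x - Φ₀ x| ≤ 1 / 2) ∧ (∀ x, (Φ x : UnitAddCircle) = φ x) ∧
      ∀ (x : E) (a : Fin k → E), (∀ i, ‖a i‖ ≤ σ) →
        (∀ A : Finset (Fin k), ‖x + ∑ i ∈ A, a i‖ ≤ θ) → |multiDiff k a Φ x| ≤ ε := by
  choose s hs hs2 using fun x => exists_coe_eq_abs_le_half (φ x - (Φ₀ x : UnitAddCircle))
  have hpow : (2 : ℝ) ^ k * (1 / 2) ^ k = 1 := by rw [← mul_pow]; norm_num
  have hcoe : ∀ (f : E → ℝ) (a : Fin k → E) (x : E),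
      ((multiDiff k a f x : ℝ) : UnitAddCircle) =
        multiDiff k a (fun y => (f y : UnitAddCircle)) x := fun f a x =>
    (multiDiff_map (QuotientAddGroup.mk' (AddSubgroup.zmultiples (1 : ℝ))) k a f x).symm
  have hΦφ : ∀ x, ((Φ₀ x + s x : ℝ) : UnitAddCircle) = φ x := fun x => by
    rw [AddCircle.coe_add, hs, add_sub_cancel]
  have hs' : ∀ x, ‖x‖ ≤ θ → 4 * |s x| ≤ (1 / 2) ^ k / 4 := fun x hx => by
    have := four_mul_abs_le_chord (hs2 x)
    rw [hs] at this
    exact this.trans (hφ x hx)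
  refine ⟨fun x => Φ₀ x + s x, fun x => by simpa using hs2 x, hΦφ, fun x a ha hxa => ?_⟩
  -- At the value `1 / 4` the chord would be at least `1`, while it is at most `ε + 1 / 4 ≤ 3 / 4`.
  -- This gap is what the connectedness argument uses.
  have hquarter : ∀ b : Fin k → E, (∀ i, ‖b i‖ ≤ σ) →
      (∀ A : Finset (Fin k), ‖x + ∑ i ∈ A, b i‖ ≤ θ) → |multiDiff k b Φ₀ x| ≠ 1 / 4 := by
    intro b hb hxb heq
    have h1 := four_mul_abs_le_chord (t := multiDiff k b Φ₀ x) (by rw [heq]; norm_num)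
    have h2 : ((multiDiff k b Φ₀ x : ℝ) : UnitAddCircle) =
        multiDiff k b φ x - multiDiff k b (fun y => φ y - (Φ₀ y : UnitAddCircle)) x := by
      rw [hcoe, multiDiff_sub, sub_sub_cancel]
    have h3 : chord (multiDiff k b (fun y => φ y - (Φ₀ y : UnitAddCircle)) x) ≤ 1 / 4 := by
      rw [multiDiff_eq_sum]
      refine (chord_sum_le_card_mul _ _ fun A _ =>
        (chord_neg_one_pow_smul _ _).trans_le (hφ _ (hxb A))).trans_eq ?_
      rw [Finset.card_univ, Fintype.card_finset, Fintype.card_fin]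
      push_cast
      linarith
    rw [heq, h2] at h1
    linarith [chord_sub_le (multiDiff k b φ x)
      (multiDiff k b (fun y => φ y - (Φ₀ y : UnitAddCircle)) x), hdiff x b hb hxb]
  -- Shrinking the edges to `t • a` joins the cube to a degenerate one with zero difference, and by
  -- convexity all vertices stay in the ball. The forbidden value is never crossed.
  have hlt : |multiDiff k a Φ₀ x| < 1 / 4 := by
    by_contra! hge
    have hc : Continuous fun t : ℝ => |multiDiff k (t • a) Φ₀ x| :=
      ((continuous_multiDiff k hΦ₀).comp
        (continuous_const.prodMk (continuous_id.smul continuous_const))).abs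
    have h0 : |multiDiff k ((0 : ℝ) • a) Φ₀ x| = 0 := by
      have := multiDiff_update_zero k (0 : Fin k → E) ⟨0, hk⟩ Φ₀ x
      rw [zero_smul, abs_eq_zero, ← this]
      congr 1
      rw [eq_comm, Function.update_eq_self_iff]
      rfl
    obtain ⟨t, ht, hteq⟩ := intermediate_value_Icc zero_le_one hc.continuousOn
      (show (1 / 4 : ℝ) ∈ Set.Icc _ _ from ⟨by rw [h0]; norm_num, by rwa [one_smul]⟩)
    refine hquarter (t • a) (fun i => ?_) (fun A => ?_) hteq
    · rw [Pi.smul_apply, norm_smul, Real.norm_of_nonneg ht.1]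
      exact (mul_le_of_le_one_left (norm_nonneg _) ht.2).trans (ha i)
    · have h1 := hxa ∅
      rw [Finset.sum_empty, add_zero] at h1
      have h2 : x + ∑ i ∈ A, (t • a) i = (1 - t) • x + t • (x + ∑ i ∈ A, a i) := by
        simp only [Pi.smul_apply, ← Finset.smul_sum, smul_add, sub_smul, one_smul]
        abel
      rw [h2]
      refine (norm_add_le _ _).trans ?_
      rw [norm_smul, norm_smul, Real.norm_of_nonneg ht.1, Real.norm_of_nonneg (sub_nonneg.2 ht.2)]
      nlinarith [hxa A, ht.1, ht.2]
  -- Below `1 / 2` the chord controls the real number itself, so no integer ambiguity is left.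
  have hsmall : |multiDiff k a (fun y => Φ₀ y + s y) x| ≤ 1 / 2 := by
    rw [multiDiff_add]
    have h1 := abs_multiDiff_le k a s x (c := (1 / 2) ^ k / 16) fun A => by
      linarith [hs' _ (hxa A)]
    have h2 : (2 : ℝ) ^ k * ((1 / 2) ^ k / 16) = 1 / 16 := by rw [← mul_div_assoc, hpow]
    rw [h2] at h1
    linarith [abs_add_le (multiDiff k a Φ₀ x) (multiDiff k a s x)]
  have h1 := four_mul_abs_le_chord hsmall
  rw [hcoe] at h1
  simp only [hΦφ] at h1
  have h2 := hdiff x a ha hxa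
  linarith [abs_nonneg (multiDiff k a (fun y => Φ₀ y + s y) x)]

end RealLift

/-! ### Polynomials: vanishing differences and Newton interpolation. -/

section Polynomial

/-- Leibniz rule `Δ_z (ℓ f) = ℓ Δ_z f + lin z · f(· + z)`: the first term falls under the induction
and the second is killed by order `d`. -/
theorem multiDiff_mul_affine {E : Type*} [AddCommGroup E] {ℓ lin : E → ℝ}
    (hℓ : ∀ x z, ℓ (x + z) = ℓ x + lin z) (d : ℕ) {f : E → ℝ}
    (hf : ∀ (a : Fin d → E) x, multiDiff d a f x = 0) (a : Fin (d + 1) → E) (x : E) :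
    multiDiff (d + 1) a (fun y => ℓ y * f y) x = 0 := by
  have hcons : ∀ (d : ℕ) (a : Fin (d + 1) → E) (f : E → ℝ) (x : E),
      multiDiff (d + 1) a f x = multiDiff d (Fin.tail a) (fwdDiff (a 0) f) x := fun d a f x => by
    conv_lhs => rw [← Fin.cons_self_tail a]
    exact multiDiff_cons_eq_fwdDiff _ _ _ _ _
  have hfwd : ∀ (f : E → ℝ) (z : E), fwdDiff z (fun y => ℓ y * f y) =
      fun y => ℓ y * fwdDiff z f y + lin z • f (y + z) := fun f z => by
    ext y
    simp only [fwdDiff, hℓ, smul_eq_mul]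
    ring
  induction d generalizing f x with
  | zero =>
    have h0 : ∀ y, f y = 0 := fun y => hf Fin.elim0 y
    simp [multiDiff, h0]
  | succ d ih =>
    rw [hcons, hfwd, multiDiff_add, multiDiff_smul, multiDiff_comp_add_right, hf, smul_zero,
      add_zero]
    refine ih (fun b y => ?_) _ _
    rw [← multiDiff_cons_eq_fwdDiff]
    exact hf _ _

theorem multiDiff_eq_zero_of_le {E : Type*} [AddCommGroup E] {d e : ℕ} (hde : d ≤ e) {f : E → ℝ}
    (hf : ∀ (a : Fin d → E) x, multiDiff d a f x = 0) (a : Fin e → E) (x : E) :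
    multiDiff e a f x = 0 := by
  induction e, hde using Nat.le_induction generalizing x with
  | base => exact hf a x
  | succ e _ ih => rw [multiDiff_succ, ih, ih, sub_zero]

variable {n : ℕ}

theorem multiDiff_multiset_prod (s : Multiset (Fin n))
    (a : Fin (s.card + 1) → EuclideanSpace ℝ (Fin n)) (x : EuclideanSpace ℝ (Fin n)) :
    multiDiff (s.card + 1) a (fun y => (s.map fun i => y i).prod) x = 0 := by
  induction s using Multiset.induction_on generalizing x with
  | empty => simp [multiDiff]
  | cons i s ih =>
    simp only [Multiset.map_cons, Multiset.prod_cons]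
    revert a
    rw [Multiset.card_cons]
    intro a
    exact multiDiff_mul_affine (lin := fun z => z i) (fun _ _ => rfl) _ ih a x

/-- Iterated differences of order larger than the degree annihilate polynomials. -/
theorem multiDiff_eval_eq_zero {d : ℕ} (P : MvPolynomial (Fin n) ℝ) (hP : P.totalDegree < d)
    (a : Fin d → EuclideanSpace ℝ (Fin n)) (x : EuclideanSpace ℝ (Fin n)) :
    multiDiff d a (fun y => MvPolynomial.eval (fun i => y i) P) x = 0 := by
  simp only [MvPolynomial.eval_eq']
  rw [multiDiff_sum]
  refine Finset.sum_eq_zero fun m hm => ?_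
  have h1 := multiDiff_smul (MvPolynomial.coeff m P) d a
    (fun y : EuclideanSpace ℝ (Fin n) => ∏ i, y i ^ m i) x
  simp only [smul_eq_mul] at h1
  rw [h1]
  have h2 : (fun y : EuclideanSpace ℝ (Fin n) => ∏ i, y i ^ m i) =
      fun y => ((Finsupp.toMultiset m).map fun i => y i).prod := by
    ext y
    rw [Finsupp.toMultiset_map, Finsupp.prod_toMultiset, Finsupp.prod_mapDomain_index
      (fun _ => pow_zero _) (fun _ _ _ => pow_add _ _ _), Finsupp.prod_fintype _ _
      fun _ => pow_zero _]
  have h3 : (Finsupp.toMultiset m).card + 1 ≤ d := by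
    rw [Finsupp.card_toMultiset]
    exact (MvPolynomial.le_totalDegree hm).trans_lt hP
  rw [h2, multiDiff_eq_zero_of_le h3 (fun a x => multiDiff_multiset_prod _ a x), mul_zero]

/-- The Newton basis polynomial which vanishes at the points `σ • m'` of the grid with
`m'` not above `m`. -/
noncomputable def newtonPoly (σ : ℝ) (m : Fin n → ℕ) : MvPolynomial (Fin n) ℝ :=
  ∏ i, ∏ l ∈ Finset.range (m i), (MvPolynomial.X i - MvPolynomial.C (σ * l))

theorem totalDegree_newtonPoly_le (σ : ℝ) (m : Fin n → ℕ) :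
    (newtonPoly σ m).totalDegree ≤ ∑ i, m i := by
  refine (MvPolynomial.totalDegree_finsetProd _ _).trans (Finset.sum_le_sum fun i _ => ?_)
  refine (MvPolynomial.totalDegree_finsetProd _ _).trans
    ((Finset.sum_le_sum (g := fun _ => 1) fun l _ => ?_).trans (by simp))
  exact (MvPolynomial.totalDegree_sub_C_le _ _).trans (MvPolynomial.totalDegree_X i).le

theorem eval_newtonPoly (σ : ℝ) (m m' : Fin n → ℕ) :
    MvPolynomial.eval (fun i => σ * m' i) (newtonPoly σ m) =
      ∏ i, ∏ l ∈ Finset.range (m i), (σ * m' i - σ * l) := by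
  simp [newtonPoly, map_prod]

theorem eval_newtonPoly_self_ne_zero {σ : ℝ} (hσ : σ ≠ 0) (m : Fin n → ℕ) :
    MvPolynomial.eval (fun i => σ * m i) (newtonPoly σ m) ≠ 0 := by
  rw [eval_newtonPoly]
  refine Finset.prod_ne_zero_iff.2 fun i _ => Finset.prod_ne_zero_iff.2 fun l hl => ?_
  rw [← mul_sub]
  refine mul_ne_zero hσ (sub_ne_zero.2 ?_)
  exact_mod_cast (Finset.mem_range.1 hl).ne'

theorem eval_newtonPoly_eq_zero (σ : ℝ) {m m' : Fin n → ℕ} (h : ¬ m ≤ m') :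
    MvPolynomial.eval (fun i => σ * m' i) (newtonPoly σ m) = 0 := by
  obtain ⟨i, hi⟩ := not_forall.1 h
  rw [eval_newtonPoly]
  refine Finset.prod_eq_zero (Finset.mem_univ i)
    (Finset.prod_eq_zero (Finset.mem_range.2 (not_le.1 hi)) (sub_self _))

/-- Newton interpolation on a simplex of grid points. Among points of weight at most `k + 1`, a
Newton polynomial of weight `k + 1` is nonzero only at its own node, so adding it disturbs no other
prescribed value. -/
theorem exists_interpolation {σ : ℝ} (hσ : σ ≠ 0) (F : (Fin n → ℕ) → ℝ) (k : ℕ) :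
    ∃ P : MvPolynomial (Fin n) ℝ, P.totalDegree ≤ k ∧
      ∀ m : Fin n → ℕ, ∑ i, m i ≤ k → MvPolynomial.eval (fun i => σ * m i) P = F m := by
  induction k with
  | zero =>
    refine ⟨MvPolynomial.C (F 0), by simp, fun m hm => ?_⟩
    have : m = 0 := by
      ext i
      have := Finset.single_le_sum (f := m) (fun _ _ => Nat.zero_le _) (Finset.mem_univ i)
      simp only [Pi.zero_apply]
      omega
    simp [this]
  | succ k ih =>
    obtain ⟨P, hP, hPF⟩ := ih
    let c : (Fin n → ℕ) → ℝ := fun m => (F m - MvPolynomial.eval (fun i => σ * m i) P) /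
      MvPolynomial.eval (fun i => σ * m i) (newtonPoly σ m)
    refine ⟨P + ∑ m ∈ Finset.univ.piAntidiag (k + 1), MvPolynomial.C (c m) * newtonPoly σ m,
      ?_, fun m' hm' => ?_⟩
    · refine (MvPolynomial.totalDegree_add _ _).trans (max_le (by omega) ?_)
      refine MvPolynomial.totalDegree_finsetSum_le fun m hm => ?_
      refine (MvPolynomial.totalDegree_mul _ _).trans ?_
      rw [MvPolynomial.totalDegree_C, zero_add]
      exact (totalDegree_newtonPoly_le σ m).trans (Finset.mem_piAntidiag.1 hm).1.le
    · rw [map_add, map_sum]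
      have hzero : ∀ m ∈ Finset.univ.piAntidiag (k + 1), m ≠ m' →
          MvPolynomial.eval (fun i => σ * m' i) (MvPolynomial.C (c m) * newtonPoly σ m) = 0 := by
        intro m hm hne
        rw [map_mul, eval_newtonPoly_eq_zero, mul_zero]
        intro hle
        refine hne (funext fun i => ?_)
        have h1 : ∑ i, m i = k + 1 := (Finset.mem_piAntidiag.1 hm).1
        exact (Finset.sum_eq_sum_iff_of_le fun i _ => hle i).1
          (le_antisymm (Finset.sum_le_sum fun i _ => hle i) (by omega)) i (Finset.mem_univ i)
      rcases Nat.lt_or_ge (∑ i, m' i) (k + 1) with hlt | hge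
      · rw [Finset.sum_eq_zero fun m hm => hzero m hm ?_, add_zero, hPF m' (by omega)]
        rintro rfl
        exact hlt.ne (Finset.mem_piAntidiag.1 hm).1
      · rw [Finset.sum_eq_single_of_mem m' (Finset.mem_piAntidiag.2
          ⟨le_antisymm hm' hge, by simp⟩) hzero,
          map_mul, MvPolynomial.eval_C, div_mul_cancel₀ _ (eval_newtonPoly_self_ne_zero hσ m')]
        ring

end Polynomial

/-! ### Whitney's theorem for bounded functions. -/

section Whitney

variable {n : ℕ}

/-- A bounded approximately additive function on an interval which is small at the right end point
is small. -/
theorem abs_le_of_approx_additive_Icc {σ ε δ M : ℝ} {L : ℝ → ℝ}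
    (hM : ∀ t ∈ Set.Icc 0 σ, |L t| ≤ M)
    (hadd : ∀ s t, 0 ≤ s → 0 ≤ t → s + t ≤ σ → |L (s + t) - L s - L t| ≤ ε) (hL : |L σ| ≤ δ)
    {t : ℝ} (ht : t ∈ Set.Icc 0 σ) : |L t| ≤ 3 * ε + 2 * δ := by
  have hσ : 0 ≤ σ := ht.1.trans ht.2
  -- The supremum improves itself. Doubling halves the bound on the lower half of the interval, and
  -- reflection `s ↦ σ - s` reduces the upper half to it. Boundedness replaces continuity.
  set S := (fun t => |L t|) '' Set.Icc 0 σ with hS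
  have hbdd : BddAbove S := ⟨M, by rintro _ ⟨s, hs, rfl⟩; exact hM s hs⟩
  have hle : ∀ s ∈ Set.Icc 0 σ, |L s| ≤ sSup S := fun s hs => le_csSup hbdd ⟨s, hs, rfl⟩
  have hδ : 0 ≤ δ := (abs_nonneg _).trans hL
  have hhalf : ∀ s, 0 ≤ s → s ≤ σ / 2 → |L s| ≤ (sSup S + ε) / 2 := by
    intro s h0 h1
    have h2 := abs_le.1 (hadd s s h0 h0 (by linarith))
    have h3 := abs_le.1 (hle (s + s) ⟨by linarith, by linarith⟩)
    rw [abs_le]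
    constructor <;> linarith
  have hall : ∀ s ∈ Set.Icc 0 σ, |L s| ≤ sSup S / 2 + (3 * ε + 2 * δ) / 2 := by
    intro s hs
    rcases le_total s (σ / 2) with h | h
    · have hε : 0 ≤ ε := (abs_nonneg _).trans (hadd 0 0 le_rfl le_rfl (by linarith))
      linarith [hhalf s hs.1 h]
    · have h1 := hadd s (σ - s) hs.1 (by linarith [hs.2]) (by linarith)
      rw [add_sub_cancel] at h1
      have h1 := abs_le.1 h1
      have h2 := abs_le.1 (hhalf (σ - s) (by linarith [hs.2]) (by linarith))
      have h3 := abs_le.1 hL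
      rw [abs_le]
      constructor <;> linarith
  have hsup : sSup S ≤ sSup S / 2 + (3 * ε + 2 * δ) / 2 :=
    csSup_le ⟨_, t, ht, rfl⟩ (by rintro _ ⟨s, hs, rfl⟩; exact hall s hs)
  linarith [hle t ht]

theorem euclideanSpace_single_add (i : Fin n) (s t : ℝ) :
    (EuclideanSpace.single i (s + t) : EuclideanSpace ℝ (Fin n)) =
      EuclideanSpace.single i s + EuclideanSpace.single i t := by
  ext j
  by_cases h : j = i <;> simp [h]

theorem norm_sum_single_le (z : EuclideanSpace ℝ (Fin n)) (s : Finset (Fin n)) :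
    ‖∑ i ∈ s, EuclideanSpace.single i (z i)‖ ≤ ‖z‖ := by
  rw [← sq_le_sq₀ (norm_nonneg _) (norm_nonneg _), EuclideanSpace.norm_sq_eq,
    EuclideanSpace.norm_sq_eq]
  refine Finset.sum_le_sum fun j _ => ?_
  have : (∑ i ∈ s, EuclideanSpace.single i (z i)) j = if j ∈ s then z j else 0 := by
    simp [WithLp.ofLp_sum, Finset.sum_apply, Pi.single_apply]
  rw [this]
  split_ifs
  · exact le_rfl
  · simp; positivity

theorem sum_single_univ (z : EuclideanSpace ℝ (Fin n)) :
    ∑ i, EuclideanSpace.single i (z i) = z := by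
  ext j
  simp [WithLp.ofLp_sum, Finset.sum_apply, Pi.single_apply]

/-- A bounded approximately additive function on a ball which is small at multiples of the basis
vectors is small. -/
theorem abs_le_of_approx_additive {σ ε δ M : ℝ} (hσ : 0 ≤ σ) {L : EuclideanSpace ℝ (Fin n) → ℝ}
    (hM : ∀ z, ‖z‖ ≤ σ → |L z| ≤ M)
    (hadd : ∀ z z', ‖z‖ ≤ σ → ‖z'‖ ≤ σ → ‖z + z'‖ ≤ σ → |L (z + z') - L z - L z'| ≤ ε)
    (hL : ∀ i, |L (EuclideanSpace.single i σ)| ≤ δ) {z : EuclideanSpace ℝ (Fin n)}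
    (hz : ‖z‖ ≤ σ) : |L z| ≤ n * (6 * ε + 2 * δ) + ε := by
  have h0 : |L 0| ≤ ε := by
    have := hadd 0 0 (by simpa) (by simpa) (by simpa)
    simpa using this
  have hpos : ∀ i, ∀ t ∈ Set.Icc 0 σ, |L (EuclideanSpace.single i t)| ≤ 3 * ε + 2 * δ := by
    intro i t ht
    refine abs_le_of_approx_additive_Icc (L := fun t => L (EuclideanSpace.single i t))
      (fun t ht => hM _ ?_) (fun s t hs ht hst => ?_) (hL i) ht
    · simpa [abs_of_nonneg ht.1] using ht.2
    · have hadd' := hadd (EuclideanSpace.single i s) (EuclideanSpace.single i t)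
      rw [← euclideanSpace_single_add] at hadd'
      refine hadd' ?_ ?_ ?_
      · simp [abs_of_nonneg hs]; linarith
      · simp [abs_of_nonneg ht]; linarith
      · simp [abs_of_nonneg (add_nonneg hs ht)]; linarith
  have hsingle : ∀ i, ∀ t, |t| ≤ σ → |L (EuclideanSpace.single i t)| ≤ 5 * ε + 2 * δ := by
    intro i t ht
    have hε : 0 ≤ ε := (abs_nonneg _).trans h0
    rcases le_total 0 t with h | h
    · linarith [hpos i t ⟨h, (le_abs_self t).trans ht⟩]
    · rw [abs_of_nonpos h] at ht
      have h1 := hadd (EuclideanSpace.single i t) (EuclideanSpace.single i (-t))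
      rw [← euclideanSpace_single_add, add_neg_cancel,
        show (EuclideanSpace.single i 0 : EuclideanSpace ℝ (Fin n)) = 0 by simp] at h1
      have h2 := abs_le.1 (h1 (by simpa [abs_of_nonpos h] using ht)
        (by simpa [abs_of_nonpos h] using ht) (by simpa))
      have h3 := abs_le.1 (hpos i (-t) ⟨by linarith, ht⟩)
      have h4 := abs_le.1 h0
      rw [abs_le]
      constructor <;> linarith
  have hfin : ∀ s : Finset (Fin n), |L (∑ i ∈ s, EuclideanSpace.single i (z i))| ≤
      s.card * (6 * ε + 2 * δ) + ε := by
    intro s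
    induction s using Finset.induction_on with
    | empty => simpa using h0
    | insert i s hi ih =>
      have hzi : ‖EuclideanSpace.single i (z i)‖ ≤ σ := by
        rw [PiLp.norm_single]
        exact (PiLp.norm_apply_le z i).trans hz
      have h1 := hadd (EuclideanSpace.single i (z i)) (∑ i ∈ s, EuclideanSpace.single i (z i)) hzi
        ((norm_sum_single_le z s).trans hz) (by
          rw [← Finset.sum_insert (f := fun i => EuclideanSpace.single i (z i)) hi]
          exact (norm_sum_single_le z _).trans hz)
      have h2 := hsingle i (z i) ((PiLp.norm_apply_le z i).trans hz)
      rw [Finset.sum_insert hi, Finset.card_insert_of_notMem hi]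
      have h1 := abs_le.1 h1
      have h2 := abs_le.1 h2
      have h3 := abs_le.1 ih
      push_cast
      rw [abs_le]
      constructor <;> linarith
  have := hfin Finset.univ
  rwa [sum_single_univ, Finset.card_univ, Fintype.card_fin] at this

/-- The function `f` has iterated differences of order `k` at most `ε` over all the cubes in the
ball of radius `θ` with edges of length at most `σ`. -/
def HasSmallDiff {E : Type*} [NormedAddCommGroup E] (θ σ : ℝ) (k : ℕ) (ε : ℝ) (f : E → ℝ) : Prop :=
  ∀ (x : E) (a : Fin k → E), (∀ i, ‖a i‖ ≤ σ) →
    (∀ A : Finset (Fin k), ‖x + ∑ i ∈ A, a i‖ ≤ θ) → |multiDiff k a f x| ≤ ε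

theorem forall_sum_cons {E : Type*} [AddCommGroup E] {k : ℕ} {p : E → Prop} {x z : E}
    {a : Fin k → E} (h0 : ∀ A : Finset (Fin k), p (x + ∑ i ∈ A, a i))
    (h1 : ∀ A : Finset (Fin k), p (x + z + ∑ i ∈ A, a i)) (A : Finset (Fin (k + 1))) :
    p (x + ∑ i ∈ A, (Fin.cons z a : Fin (k + 1) → E) i) := by
  classical
  have hA : ∃ B : Finset (Fin k), A = B.map (Fin.succEmb k) ∨
      A = insert 0 (B.map (Fin.succEmb k)) := by
    refine ⟨Finset.univ.filter fun i => i.succ ∈ A, ?_⟩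
    by_cases h : (0 : Fin (k + 1)) ∈ A
    · right
      ext i
      refine Fin.cases (by simp [h]) (fun j => by simp [Fin.succ_ne_zero]) i
    · left
      ext i
      refine Fin.cases (by simp [h, Fin.succ_ne_zero]) (fun j => by simp) i
  obtain ⟨B, rfl | rfl⟩ := hA
  · simpa using h0 B
  · rw [Finset.sum_insert (by simp [Fin.succ_ne_zero])]
    simpa [add_assoc] using h1 B

theorem norm_sum_le_of_small {E : Type*} [NormedAddCommGroup E] {k : ℕ} {σ θ : ℝ} (hσ : 0 ≤ σ)
    (hσθ : k * σ ≤ θ) {a : Fin k → E} (ha : ∀ i, ‖a i‖ ≤ σ) (A : Finset (Fin k)) :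
    ‖∑ i ∈ A, a i‖ ≤ θ := by
  refine (norm_sum_le_of_le A fun i _ => ha i).trans (le_trans ?_ hσθ)
  rw [Finset.sum_const, nsmul_eq_mul]
  gcongr
  exact (Finset.card_le_univ A).trans_eq (Fintype.card_fin k)

/-- Small differences of order `k + 1` give small differences of order `k` based at the origin, if
those along the basis vectors vanish. -/
theorem exists_abs_multiDiff_zero_le (k : ℕ) {θ σ : ℝ} (hσ : 0 ≤ σ) (hσθ : (k + 1) * σ ≤ θ) :
    ∃ C : ℝ, 0 ≤ C ∧ ∀ (f : EuclideanSpace ℝ (Fin n) → ℝ) (ε : ℝ),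
      (∃ M, ∀ x, ‖x‖ ≤ θ → |f x| ≤ M) → HasSmallDiff θ σ (k + 1) ε f →
      (∀ l : Fin k → Fin n, multiDiff k (fun i => EuclideanSpace.single (l i) σ) f 0 = 0) →
      ∀ a : Fin k → EuclideanSpace ℝ (Fin n), (∀ i, ‖a i‖ ≤ σ) → |multiDiff k a f 0| ≤ C * ε := by
  classical
  -- The edges in `s` are arbitrary, the others are basis vectors of length `σ`; one edge is freed
  -- at a time.
  have key : ∀ s : Finset (Fin k), ∃ C : ℝ, 0 ≤ C ∧
      ∀ (f : EuclideanSpace ℝ (Fin n) → ℝ) (ε : ℝ),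
      (∃ M, ∀ x, ‖x‖ ≤ θ → |f x| ≤ M) → HasSmallDiff θ σ (k + 1) ε f →
      (∀ l : Fin k → Fin n, multiDiff k (fun i => EuclideanSpace.single (l i) σ) f 0 = 0) →
      ∀ a : Fin k → EuclideanSpace ℝ (Fin n), (∀ i, ‖a i‖ ≤ σ) →
        (∀ i ∉ s, ∃ l, a i = EuclideanSpace.single l σ) → |multiDiff k a f 0| ≤ C * ε := by
    intro s
    induction s using Finset.induction_on with
    | empty =>
      refine ⟨0, le_rfl, fun f ε _ _ hf a _ ha => ?_⟩
      choose l hl using fun i => ha i (Finset.notMem_empty i)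
      rw [show a = _ from funext hl, hf l]
      simp
    | insert i s hi ih =>
      obtain ⟨C, hC0, hC⟩ := ih
      refine ⟨n * (6 + 2 * C) + 1, by positivity, fun f ε hfM hfε hf a ha has => ?_⟩
      obtain ⟨M, hM⟩ := hfM
      have hupd : ∀ z, ‖z‖ ≤ σ → ∀ j, ‖Function.update a i z j‖ ≤ σ := fun z hz j => by
        by_cases hj : j = i
        · subst hj; simpa using hz
        · rw [Function.update_of_ne hj]; exact ha j
      have hkσ : k * σ ≤ θ := by linarith
      have h1 := abs_le_of_approx_additive (σ := σ) (ε := ε) (δ := C * ε) (M := 2 ^ k * M)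
        (L := fun z => multiDiff k (Function.update a i z) f 0) hσ
        (fun z hz => abs_multiDiff_le k _ f 0 fun A => hM _ (by
          rw [zero_add]; exact norm_sum_le_of_small hσ hkσ (hupd z hz) A))
        (fun z z' hz hz' _ => by
          have e1 := multiDiff_update_add k a i z z' f 0
          have e2 := multiDiff_cons k z (Function.update a i z') f 0
          -- The additivity defect in edge `i` is exactly a difference of order `k + 1`.
          have e3 : multiDiff k (Function.update a i (z + z')) f 0 -
              multiDiff k (Function.update a i z) f 0 - multiDiff k (Function.update a i z') f 0 =
              multiDiff (k + 1) (Fin.cons z (Function.update a i z')) f 0 := by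
            rw [e1, e2]; ring
          rw [e3]
          have hc : ∀ j, ‖(Fin.cons z (Function.update a i z') :
              Fin (k + 1) → EuclideanSpace ℝ (Fin n)) j‖ ≤ σ :=
            Fin.cases hz (hupd z' hz')
          refine hfε _ _ hc fun A => ?_
          rw [zero_add]
          exact norm_sum_le_of_small hσ (by push_cast; exact hσθ) hc A)
        (fun l => hC f ε ⟨M, hM⟩ hfε hf _ (hupd _ (by simp [abs_of_nonneg hσ])) fun j hj => by
          by_cases hji : j = i
          · subst hji; exact ⟨l, by simp⟩
          · rw [Function.update_of_ne hji]
            exact has j (by simp [hji, hj]))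
        (ha i)
      simp only [Function.update_eq_self] at h1
      linarith
  obtain ⟨C, hC0, hC⟩ := key Finset.univ
  exact ⟨C, hC0, fun f ε hM hε hf a ha => hC f ε hM hε hf a ha fun i hi =>
    absurd (Finset.mem_univ i) hi⟩

/-- The base point moves from the origin to `x` in `N` steps of length at most `σ`, each costing one
difference of order `k + 1`. By convexity the intermediate cubes stay in the ball. -/
theorem exists_hasSmallDiff (k : ℕ) {θ σ : ℝ} (hσ : 0 < σ) (hσθ : (k + 1) * σ ≤ θ) :
    ∃ C : ℝ, 0 ≤ C ∧ ∀ (f : EuclideanSpace ℝ (Fin n) → ℝ) (ε : ℝ),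
      (∃ M, ∀ x, ‖x‖ ≤ θ → |f x| ≤ M) → HasSmallDiff θ σ (k + 1) ε f →
      (∀ l : Fin k → Fin n, multiDiff k (fun i => EuclideanSpace.single (l i) σ) f 0 = 0) →
      HasSmallDiff θ σ k (C * ε) f := by
  obtain ⟨C, hC0, hC⟩ := exists_abs_multiDiff_zero_le (n := n) k hσ.le hσθ
  obtain ⟨N, hN⟩ := exists_nat_gt (θ / σ)
  have hθ : 0 < θ := by nlinarith [(Nat.cast_nonneg k : (0 : ℝ) ≤ k)]
  have hN0 : 0 < (N : ℝ) := (div_pos hθ hσ).trans hN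
  have hNσ : θ / N ≤ σ := by
    rw [div_lt_iff₀ hσ] at hN
    rw [div_le_iff₀ hN0]
    linarith
  refine ⟨C + N, by positivity, fun f ε hfM hfε hf x a ha hxa => ?_⟩
  have hkσ : k * σ ≤ θ := by linarith
  have hmid : ∀ t : ℝ, 0 ≤ t → t ≤ 1 → ∀ A : Finset (Fin k), ‖t • x + ∑ i ∈ A, a i‖ ≤ θ := by
    intro t h0 h1 A
    have h2 : t • x + ∑ i ∈ A, a i =
        (1 - t) • ∑ i ∈ A, a i + t • (x + ∑ i ∈ A, a i) := by
      rw [smul_add, sub_smul, one_smul]; abel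
    rw [h2]
    refine (norm_add_le _ _).trans ?_
    rw [norm_smul, norm_smul, Real.norm_of_nonneg h0, Real.norm_of_nonneg (sub_nonneg.2 h1)]
    nlinarith [hxa A, norm_sum_le_of_small hσ.le hkσ ha A]
  have hxθ : ‖x‖ ≤ θ := by simpa using hxa ∅
  have hstep : ∀ m : ℕ, m ≤ N →
      |multiDiff k a f (((m : ℝ) / N) • x) - multiDiff k a f 0| ≤ m * ε := by
    intro m
    induction m with
    | zero => simp
    | succ m ih =>
      intro hm
      have h1 := ih (by omega)
      have hm' : (m : ℝ) + 1 ≤ N := by exact_mod_cast hm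
      have hadd : ((m : ℝ) / N) • x + (1 / (N : ℝ)) • x = ((m + 1 : ℕ) / (N : ℝ)) • x := by
        rw [← add_smul]; push_cast; congr 1; ring
      have hz : ‖(1 / (N : ℝ)) • x‖ ≤ σ := by
        rw [norm_smul, Real.norm_of_nonneg (by positivity), one_div, inv_mul_eq_div]
        exact (by gcongr : ‖x‖ / N ≤ θ / N).trans hNσ
      have h2 := hfε (((m : ℝ) / N) • x) (Fin.cons ((1 / (N : ℝ)) • x) a) (Fin.cases hz ha)
        (forall_sum_cons (p := fun y => ‖y‖ ≤ θ)
          (hmid _ (by positivity) ((div_le_one hN0).2 (by linarith)))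
          (by
            rw [hadd]
            exact hmid _ (by positivity) ((div_le_one hN0).2 (by push_cast; linarith))))
      rw [multiDiff_cons, hadd] at h2
      have h1 := abs_le.1 h1
      have h2 := abs_le.1 h2
      push_cast at h2 ⊢
      rw [abs_le]
      constructor <;> linarith
  have h1 := hstep N le_rfl
  rw [div_self hN0.ne', one_smul] at h1
  have h2 := hC f ε hfM hfε hf a ha
  have h1 := abs_le.1 h1
  have h2 := abs_le.1 h2
  rw [abs_le]
  constructor <;> linarith

/-- The order descends one unit at a time to `0`, where the difference is the function itself. -/
theorem exists_abs_le_of_hasSmallDiff (k : ℕ) {θ σ : ℝ} (hσ : 0 < σ) (hσθ : k * σ ≤ θ) :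
    ∃ C : ℝ, 0 ≤ C ∧ ∀ (f : EuclideanSpace ℝ (Fin n) → ℝ) (ε : ℝ),
      (∃ M, ∀ x, ‖x‖ ≤ θ → |f x| ≤ M) → HasSmallDiff θ σ k ε f →
      (∀ j < k, ∀ l : Fin j → Fin n,
        multiDiff j (fun i => EuclideanSpace.single (l i) σ) f 0 = 0) →
      ∀ x, ‖x‖ ≤ θ → |f x| ≤ C * ε := by
  induction k with
  | zero =>
    refine ⟨1, zero_le_one, fun f ε _ hf _ x hx => ?_⟩
    rw [one_mul]
    exact hf x Fin.elim0 (fun i => i.elim0) fun A => by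
      rw [Subsingleton.elim A ∅]; simpa using hx
  | succ k ih =>
    push_cast at hσθ
    obtain ⟨C, hC0, hC⟩ := ih (by linarith)
    obtain ⟨C', hC0', hC'⟩ := exists_hasSmallDiff (n := n) k hσ hσθ
    refine ⟨C * C', by positivity, fun f ε hM hf hzero x hx => ?_⟩
    rw [mul_assoc]
    exact hC f (C' * ε) hM (hC' f ε hM hf (hzero k (by omega))) (fun j hj => hzero j (by omega))
      x hx

/-- Whitney's theorem on a ball: a bounded function with small iterated differences of order `k + 1`
is close to a polynomial of degree at most `k`. -/
theorem exists_polynomial_near_of_hasSmallDiff (n k : ℕ) {θ σ : ℝ} (hσ : 0 < σ)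
    (hσθ : (k + 1) * σ ≤ θ) :
    ∃ C : ℝ, 0 ≤ C ∧ ∀ (f : EuclideanSpace ℝ (Fin n) → ℝ) (ε : ℝ),
      (∃ M, ∀ x, ‖x‖ ≤ θ → |f x| ≤ M) → HasSmallDiff θ σ (k + 1) ε f →
      ∃ P : MvPolynomial (Fin n) ℝ, P.totalDegree ≤ k ∧
        ∀ x : EuclideanSpace ℝ (Fin n), ‖x‖ ≤ θ →
          |f x - MvPolynomial.eval (fun i => x i) P| ≤ C * ε := by
  obtain ⟨C, hC0, hC⟩ := exists_abs_le_of_hasSmallDiff (n := n) (k + 1) hσ (by exact_mod_cast hσθ)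
  refine ⟨C, hC0, fun f ε ⟨M, hM⟩ hf => ?_⟩
  -- Differences of order at most `k` along basis vectors at the origin see only grid points of
  -- weight at most `k`, so interpolating there makes them vanish for `f - P`.
  obtain ⟨P, hP, hPf⟩ := exists_interpolation hσ.ne'
    (fun m : Fin n → ℕ => f (WithLp.toLp 2 fun i => σ * m i)) k
  have hPc : Continuous fun x : EuclideanSpace ℝ (Fin n) => MvPolynomial.eval (fun i => x i) P :=
    (MvPolynomial.continuous_eval P).comp (by fun_prop)
  obtain ⟨M', hM'⟩ :=
    (isCompact_closedBall (0 : EuclideanSpace ℝ (Fin n)) θ).exists_bound_of_continuousOn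
      hPc.continuousOn
  refine ⟨P, hP, hC (fun x => f x - MvPolynomial.eval (fun i => x i) P) ε
    ⟨M + M', fun x hx => (abs_sub _ _).trans (add_le_add (hM x hx) ?_)⟩ (fun x a ha hxa => ?_)
    fun j hj l => ?_⟩
  · exact hM' x (by simpa using hx)
  · rw [multiDiff_sub, multiDiff_eval_eq_zero P (by omega), sub_zero]
    exact hf x a ha hxa
  · rw [multiDiff_eq_sum]
    refine Finset.sum_eq_zero fun A _ => ?_
    have hgrid : (0 + ∑ i ∈ A, EuclideanSpace.single (l i) σ : EuclideanSpace ℝ (Fin n)) =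
        WithLp.toLp 2 fun i' => σ * ((A.filter fun i => l i = i').card : ℕ) := by
      ext i'
      simp [WithLp.ofLp_sum, Finset.sum_apply, Pi.single_apply, Finset.sum_ite, mul_comm, eq_comm]
    rw [hgrid]
    have h1 := hPf (fun i' => (A.filter fun i => l i = i').card) (by
      rw [← Finset.card_eq_sum_card_fiberwise (fun _ _ => Finset.mem_univ _)]
      have := (Finset.card_le_univ A).trans_eq (Fintype.card_fin j)
      omega)
    simp only [h1, sub_self, smul_zero]

end Whitney

theorem measure_le_measure_fiber_le {X Y : Type*} [MeasurableSpace X] [MeasurableSpace Y]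
    (μ : Measure X) (ν : Measure Y) [SFinite μ] [SFinite ν] {N : Set (X × Y)}
    (hN : MeasurableSet N) {c : ℝ≥0∞} (hc0 : c ≠ 0) (hctop : c ≠ ∞) :
    μ {x | c ≤ ν {y | (x, y) ∈ N}} ≤ c⁻¹ * μ.prod ν N := by
  rw [Measure.prod_apply hN, ← ENNReal.div_eq_inv_mul]
  exact meas_ge_le_lintegral_div (measurable_measure_prodMk_left hN).aemeasurable hc0 hctop

/-! ### From a smaller ball to the whole unit ball. -/

section Bootstrap

variable {E : Type*} [NormedAddCommGroup E]

theorem isOpen_badCubes (k : ℕ) {g : E → UnitAddCircle} (hg : Continuous g) (τ : ℝ) :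
    IsOpen (badCubes k g τ) :=
  (isOpen_cubeSet Metric.isOpen_ball k).inter
    (isOpen_lt continuous_const (continuous_chord.comp (continuous_multiDiff k hg)))

variable [NormedSpace ℝ E] [FiniteDimensional ℝ E]
  [MeasureSpace E] [BorelSpace E] [SecondCountableTopology E]
  [(volume : Measure E).IsAddHaarMeasure]

/-- If `q` is small at most points of a smaller ball, then it is small at most points of the unit
ball, with an exceptional set whose size is controlled by the measure of the bad cubes. -/
theorem exists_measure_ball_le (k : ℕ) (hk : 1 ≤ k) :
    ∃ (δ : ℝ≥0∞) (K : ℝ≥0), 0 < δ ∧ ∀ q : E → UnitAddCircle, Continuous q → ∀ τ ρ : ℝ, 0 ≤ ρ →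
      volume {x : E | ‖x‖ ≤ 1 - 1 / (2 * (k + 1)) ∧ ρ < chord (q x)} ≤ δ →
      volume {x : E | x ∈ Metric.ball 0 1 ∧ τ + 2 ^ k * ρ < chord (q x)} ≤
        K * volume (badCubes k q τ) := by
  classical
  -- Chosen so that `k * r ≤ 1 / (2 * (k + 1))`, half of the inward gain `1 / (k + 1)` of a vertex.
  set r : ℝ := 1 / (2 * (k + 1) ^ 2) with hrdef
  have hk1 : (1 : ℝ) ≤ k := by exact_mod_cast hk
  have hr : 0 < r := by positivity
  let T : Finset (Fin k) → (Fin k → E) →ₗ[ℝ] E := fun A => ∑ i ∈ A, LinearMap.proj i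
  have hTapp : ∀ A h, T A h = ∑ i ∈ A, h i := fun A h => by simp [T]
  have hT : ∀ A : Finset (Fin k), A ≠ ∅ → Function.Surjective (T A) := by
    rintro A hA z
    obtain ⟨i₀, hi₀⟩ := Finset.nonempty_iff_ne_empty.2 hA
    exact ⟨Pi.single i₀ z, by rw [hTapp]; simp [hi₀]⟩
  have hT' : ∀ A : Finset (Fin k), ∃ C : ℝ≥0, A ≠ ∅ → ∀ (y₀ : E) N,
      volume (Metric.closedBall (0 : Fin k → E) 1 ∩ {w | y₀ + T A w ∈ N}) ≤ C * volume N :=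
    fun A => by
      by_cases hA : A = ∅
      · exact ⟨0, fun h => absurd hA h⟩
      · obtain ⟨C, h⟩ := exists_measure_inter_preimage_le volume volume (T A) (hT A hA)
          (Metric.isBounded_closedBall (x := (0 : Fin k → E)) (r := 1))
        exact ⟨C, fun _ => h⟩
  choose C hC using hT'
  set m : ℝ≥0∞ := volume (Metric.closedBall (0 : Fin k → E) r) with hm
  have hm0 : m ≠ 0 := (Metric.measure_closedBall_pos _ _ hr).ne'
  have hmtop : m ≠ ∞ := measure_closedBall_lt_top.ne
  have hm2 : m / 2 ≠ 0 := (ENNReal.half_pos hm0).ne'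
  have hm2top : m / 2 ≠ ∞ := ENNReal.div_ne_top hmtop two_ne_zero
  set M : ℝ≥0 := ∑ A, C A with hM
  refine ⟨m / 2 / (M + 1), ((m / 2)⁻¹).toNNReal, ENNReal.div_pos hm2 (by simp),
    fun q hq τ ρ hρ hE => ?_⟩
  set E₀ : Set E := {x : E | ‖x‖ ≤ 1 - 1 / (2 * (k + 1)) ∧ ρ < chord (q x)} with hE₀
  rw [ENNReal.coe_toNNReal (ENNReal.inv_ne_top.2 hm2)]
  refine le_trans (measure_mono ?_) (measure_le_measure_fiber_le volume volume
    (isOpen_badCubes k hq τ).measurableSet hm2 hm2top)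
  rintro x ⟨hx, hlt⟩
  by_contra hfew
  simp only [Set.mem_ofPred_eq, not_le] at hfew
  rw [mem_ball_zero_iff] at hx
  -- With edges near `-x / (k + 1)`, a vertex using `1 ≤ A.card ≤ k` of them lies near `(1 - A.card
  -- / (k + 1)) • x`, inside the smaller ball.
  set c : Fin k → E := fun _ => -((1 / ((k : ℝ) + 1)) • x) with hc
  set H : Set (Fin k → E) := Metric.closedBall c r with hH
  have hHm : volume H = m := Measure.addHaar_closedBall_center _ _ _
  have hr8 : r ≤ 1 / 8 := by
    rw [hrdef]
    gcongr
    nlinarith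
  have hk2 : 1 / ((k : ℝ) + 1) ≤ 1 / 2 := by gcongr; linarith
  have hkpos : 0 < 1 / ((k : ℝ) + 1) := by positivity
  have hdir : ∀ h ∈ H, ∀ i, ∃ u : E, ‖u‖ ≤ r ∧ h i = -((1 / ((k : ℝ) + 1)) • x) + u := by
    intro h hh i
    refine ⟨(h - c) i, (norm_le_pi_norm _ i).trans (mem_closedBall_iff_norm.1 hh), ?_⟩
    simp [hc]
  have hHnorm : ∀ h ∈ H, ∀ i, ‖h i‖ < 1 := by
    intro h hh i
    obtain ⟨u, hu, hhi⟩ := hdir h hh i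
    rw [hhi]
    refine (norm_add_le _ _).trans_lt ?_
    rw [norm_neg, norm_smul, Real.norm_of_nonneg hkpos.le]
    nlinarith [norm_nonneg x]
  have hvert : ∀ h ∈ H, ∀ A : Finset (Fin k), A ≠ ∅ →
      ‖x + ∑ i ∈ A, h i‖ ≤ 1 - 1 / (2 * (k + 1)) := by
    intro h hh A hA
    choose u hu hhu using hdir h hh
    have hcard : A.card ≤ k := (Finset.card_le_univ A).trans_eq (Fintype.card_fin k)
    have hcard' : (A.card : ℝ) ≤ k := by exact_mod_cast hcard
    have hcard1 : (1 : ℝ) ≤ A.card := by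
      exact_mod_cast Finset.card_pos.2 (Finset.nonempty_iff_ne_empty.2 hA)
    have hsum : x + ∑ i ∈ A, h i = (1 - A.card * (1 / ((k : ℝ) + 1))) • x + ∑ i ∈ A, u i := by
      simp only [hhu, Finset.sum_add_distrib, Finset.sum_const, smul_neg, sub_smul, one_smul,
        mul_smul, Nat.cast_smul_eq_nsmul]
      abel
    have h1 : ‖∑ i ∈ A, u i‖ ≤ k * r := by
      refine (norm_sum_le_of_le A fun i _ => hu i).trans ?_
      rw [Finset.sum_const, nsmul_eq_mul]
      gcongr
    have h2 : (k : ℝ) * r ≤ 1 / (2 * (k + 1)) := by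
      rw [hrdef, mul_one_div, div_le_div_iff₀ (by positivity) (by positivity)]
      nlinarith
    have h3 : (1 : ℝ) / (2 * (k + 1)) = (1 / ((k : ℝ) + 1)) / 2 := by
      field_simp
    have h5 : ((k : ℝ) + 1) * (1 / ((k : ℝ) + 1)) = 1 := by field_simp
    have h4 : 0 ≤ 1 - A.card * (1 / ((k : ℝ) + 1)) := by nlinarith
    rw [hsum]
    refine (norm_add_le _ _).trans ?_
    rw [norm_smul, Real.norm_of_nonneg h4]
    have h6 : (1 - A.card * (1 / ((k : ℝ) + 1))) * ‖x‖ ≤ 1 - 1 / ((k : ℝ) + 1) := by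
      nlinarith [norm_nonneg x]
    linarith
  have hcube : ∀ h ∈ H, (x, h) ∈ cubeSet (Metric.ball (0 : E) 1) k := by
    intro h hh
    refine ⟨by simpa using hx, fun i => by simpa using hHnorm h hh i, fun A => ?_⟩
    by_cases hA : A = ∅
    · subst hA; simpa using hx
    · have h1 := hvert h hh A hA
      have h2 : 0 < (1 : ℝ) / (2 * (k + 1)) := by positivity
      rw [mem_ball_zero_iff]
      linarith
  -- Less than half of `H` gives bad cubes, and by the choice of `δ` at most half has another vertex
  -- in `E₀`; the strict inequality leaves a good `h`.
  obtain ⟨h, hhH, hh⟩ : ∃ h ∈ H, h ∉ {h | (x, h) ∈ badCubes k q τ} ∪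
      ⋃ A ∈ Finset.univ.erase (∅ : Finset (Fin k)),
        Metric.closedBall (0 : Fin k → E) 1 ∩ {w | x + T A w ∈ E₀} := by
    by_contra! hcon
    have h1 : m < m / 2 + m / 2 := by
      calc m = volume H := hHm.symm
        _ ≤ volume {h | (x, h) ∈ badCubes k q τ} +
            volume (⋃ A ∈ Finset.univ.erase (∅ : Finset (Fin k)),
              Metric.closedBall (0 : Fin k → E) 1 ∩ {w | x + T A w ∈ E₀}) :=
          (measure_mono hcon).trans (measure_union_le _ _)
        _ < m / 2 + m / 2 := by
          refine ENNReal.add_lt_add_of_lt_of_le (ne_top_of_le_ne_top hm2top ?_) hfew ?_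
          all_goals
            refine (measure_biUnion_finset_le _ _).trans ((Finset.sum_le_sum fun A hA =>
              hC A (Finset.ne_of_mem_erase hA) x E₀).trans ?_)
            rw [← Finset.sum_mul, ← ENNReal.ofNNReal_finsetSum]
            calc _ ≤ ((M : ℝ≥0∞) + 1) * (m / 2 / (M + 1)) := by
                  gcongr
                  refine le_trans ?_ le_self_add
                  exact_mod_cast Finset.sum_le_sum_of_subset (Finset.erase_subset _ _)
              _ = m / 2 := ENNReal.mul_div_cancel (by simp) (by finiteness)
    rw [ENNReal.add_halves] at h1
    exact lt_irrefl _ h1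
  simp only [Set.mem_union, Set.mem_iUnion, Set.mem_inter_iff, Set.mem_ofPred_eq, not_or,
    not_exists, not_and, hTapp] at hh
  obtain ⟨hgood, hgoodA⟩ := hh
  have hball : h ∈ Metric.closedBall (0 : Fin k → E) 1 := by
    rw [mem_closedBall_zero_iff, pi_norm_le_iff_of_nonneg zero_le_one]
    exact fun i => (hHnorm h hhH i).le
  have hΔ : chord (multiDiff k h q x) ≤ τ := by
    by_contra! hcon
    exact hgood ⟨hcube h hhH, hcon⟩
  have hA : ∀ A ∈ Finset.univ.erase (∅ : Finset (Fin k)), chord (q (x + ∑ i ∈ A, h i)) ≤ ρ := by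
    intro A hA
    by_contra! hcon
    exact hgoodA A hA hball ⟨hvert h hhH A (Finset.ne_of_mem_erase hA), hcon⟩
  have hV : chord (vertexValue k h q x) ≤ 2 ^ k * ρ := by
    rw [vertexValue_eq_sum, chord_neg]
    refine (chord_sum_le_card_mul _ _ fun A hA' =>
      (chord_neg_one_pow_smul _ _).trans_le (hA A hA')).trans ?_
    gcongr
    exact_mod_cast (Finset.card_le_univ _).trans_eq (by simp)
  have hqx : q x = vertexValue k h q x + (-1 : ℤ) ^ k • multiDiff k h q x := by
    rw [vertexValue, sub_add_cancel]
  have := chord_add_le (vertexValue k h q x) ((-1 : ℤ) ^ k • multiDiff k h q x)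
  rw [← hqx, chord_neg_one_pow_smul] at this
  linarith

end Bootstrap

/-! ### The theorem for continuous functions. -/

/-- The theorem for continuous functions on the unit ball. -/
theorem exists_polynomial_near_of_continuous (n k : ℕ) (hk : 1 ≤ k) :
    ∃ (δ : ℝ≥0∞) (τ₀ C : ℝ) (K : ℝ≥0), 0 < δ ∧ 0 < τ₀ ∧ 0 ≤ C ∧
      ∀ g : EuclideanSpace ℝ (Fin n) → UnitAddCircle, Continuous g → ∀ τ : ℝ, 0 < τ → τ ≤ τ₀ →
        volume (badCubes k g τ) ≤ δ →
        ∃ P : MvPolynomial (Fin n) ℝ, P.totalDegree ≤ k - 1 ∧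
          volume {x : EuclideanSpace ℝ (Fin n) | x ∈ Metric.ball 0 1 ∧ C * τ <
            chord (g x - (MvPolynomial.eval (fun i => x i) P : ℝ))} ≤
              K * volume (badCubes k g τ) := by
  have hk1 : (1 : ℝ) ≤ k := by exact_mod_cast hk
  set b : ℝ := 1 / (k + 1) with hb
  have hb0 : 0 < b := by positivity
  have hkb : (k + 1) * b = 1 := by rw [hb]; field_simp
  have hb2 : b ≤ 1 / 2 := by nlinarith
  set θ : ℝ := 1 - 1 / (2 * (k + 1)) with hθdef
  have hθb : θ = 1 - b / 2 := by rw [hθdef, hb]; field_simp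
  have hθ : 0 < θ := by linarith
  -- With `b = 1 / (k + 1)` this gives `(k + 1) * r = b ^ 2 / 8` and `k * ((k + 1) * r) ≤ b / 8`, so
  -- the auxiliary cubes fit in the margin `b / 2` left by `θ`.
  set r : ℝ := b ^ 3 / 8 with hr
  have hr0 : 0 < r := by positivity
  have hkr : (k + 1) * r = b ^ 2 / 8 := by rw [hr]; linear_combination b ^ 2 / 8 * hkb
  have hkkr : k * ((k + 1) * r) ≤ b / 8 := by
    rw [hkr]
    nlinarith
  obtain ⟨C₁, hC₁⟩ := exists_corrected_function (E := EuclideanSpace ℝ (Fin n)) k (θ := θ)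
    (r := (k + 1) * r) (by positivity) (by rw [hθb]; nlinarith) (by rw [hkr]; nlinarith)
  obtain ⟨δ₁, hδ₁, H₁⟩ := exists_chord_multiDiff_corrected_le (E := EuclideanSpace ℝ (Fin n)) k hk
    (θ := θ) (r := r) (σ := b / 2) hr0 (by rw [hθb]; nlinarith) (by nlinarith) C₁
  set κ : ℝ := (1 / 2) ^ k / 4 with hκ
  have hκ0 : 0 < κ := by positivity
  have hκ1 : κ ≤ 1 := by
    have : (1 / 2 : ℝ) ^ k ≤ 1 := pow_le_one₀ (by norm_num) (by norm_num)
    linarith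
  obtain ⟨δ₂, hδ₂, H₂⟩ := exists_continuous_chord_le (E := EuclideanSpace ℝ (Fin n)) k (θ := θ)
    (r := (k + 1) * r) hθ (by positivity) hκ0 hκ1 C₁
  obtain ⟨Cw, hCw0, hCw⟩ := exists_polynomial_near_of_hasSmallDiff n (k - 1) (θ := θ) (σ := b / 2)
    (by positivity) (by
      rw [hθb, Nat.cast_sub hk]; push_cast; nlinarith)
  rw [Nat.sub_add_cancel hk] at hCw
  obtain ⟨δ₃, K, hδ₃, H₃⟩ := exists_measure_ball_le (E := EuclideanSpace ℝ (Fin n)) k hk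
  set D : Set (Fin k → EuclideanSpace ℝ (Fin n)) := Metric.closedBall 0 ((k + 1) * r) with hD
  have hD0 : volume D ≠ 0 := (Metric.measure_closedBall_pos _ _ (by positivity)).ne'
  have hDtop : volume D ≠ ∞ := measure_closedBall_lt_top.ne
  have hD2 : volume D / 2 ≠ 0 := (ENNReal.half_pos hD0).ne'
  have hD2top : volume D / 2 ≠ ∞ := ENNReal.div_ne_top hDtop two_ne_zero
  set ε₁ : ℝ := 2 ^ k * (k + 1) with hε₁
  have hε₁0 : 0 < ε₁ := by positivity
  -- In units of `τ`: `1` from `g` to its prediction, `k` from the prediction to `φ`, and the rest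
  -- from the lift `Φ` of `φ` to `P`.
  set ρ₁ : ℝ := (k + 1) + 2 * Real.pi * (Cw * ε₁) with hρ₁
  have hρ₁0 : 0 ≤ ρ₁ := by positivity
  refine ⟨min (min δ₁ δ₂) (min (volume D / 2 * δ₃) (volume D / 2 / (C₁ + 1))),
    min (κ / (4 * k)) (1 / (2 * ε₁)), 1 + 2 ^ k * ρ₁, K, ?_, by positivity, by positivity,
    fun g hg τ hτ hττ hN => ?_⟩
  · refine lt_min (lt_min hδ₁ hδ₂) (lt_min ?_ (ENNReal.div_pos hD2 (by simp)))
    exact pos_iff_ne_zero.2 (mul_ne_zero hD2 hδ₃.ne')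
  obtain ⟨⟨hN₁, hN₂⟩, hN₃, hN₄⟩ := (le_min_iff.1 hN).imp le_min_iff.1 le_min_iff.1
  obtain ⟨hτ₁, hτ₂⟩ := le_min_iff.1 hττ
  have hkτ : k * τ ≤ κ / 4 := by
    rw [le_div_iff₀ (by positivity)] at hτ₁
    linarith
  have hετ : ε₁ * τ ≤ 1 / 2 := by
    rw [le_div_iff₀ (by positivity)] at hτ₂
    linarith
  obtain ⟨φ, hφ⟩ := hC₁ g hg τ
  obtain ⟨Φ₀, hΦ₀c, hΦ₀⟩ := H₂ g hg τ φ hkτ hφ hN₂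
  obtain ⟨Φ, hΦΦ₀, hΦφ, hΦ⟩ := exists_real_lift k hk hετ hΦ₀c hΦ₀ (H₁ g τ φ hφ hN₁)
  obtain ⟨M, hM⟩ :=
    (isCompact_closedBall (0 : EuclideanSpace ℝ (Fin n)) θ).exists_bound_of_continuousOn
      hΦ₀c.continuousOn
  obtain ⟨P, hP, hPΦ⟩ := hCw Φ (ε₁ * τ) ⟨1 / 2 + M, fun x hx => by
    have h1 := hM x (by simpa using hx)
    rw [Real.norm_eq_abs] at h1
    have h2 := abs_add_le (Φ x - Φ₀ x) (Φ₀ x)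
    rw [sub_add_cancel] at h2
    linarith [hΦΦ₀ x]⟩ hΦ
  refine ⟨P, hP, ?_⟩
  have hPc : Continuous fun x : EuclideanSpace ℝ (Fin n) => MvPolynomial.eval (fun i => x i) P :=
    (MvPolynomial.continuous_eval P).comp (by fun_prop)
  set q : EuclideanSpace ℝ (Fin n) → UnitAddCircle :=
    fun x => g x - (MvPolynomial.eval (fun i => x i) P : ℝ) with hq
  have hqc : Continuous q := hg.sub ((AddCircle.continuous_mk' 1).comp hPc)
  -- `P` has degree below `k`, so subtracting it changes no difference of order `k`.
  have hqbad : badCubes k q τ = badCubes k g τ := by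
    have : ∀ (h : Fin k → EuclideanSpace ℝ (Fin n)) x, multiDiff k h q x = multiDiff k h g x := by
      intro h x
      have h1 := multiDiff_map (QuotientAddGroup.mk' (AddSubgroup.zmultiples (1 : ℝ))) k h
        (fun y : EuclideanSpace ℝ (Fin n) => MvPolynomial.eval (fun i => y i) P) x
      rw [multiDiff_eval_eq_zero P (by omega), map_zero] at h1
      rw [hq, multiDiff_sub]
      exact (congrArg _ h1).trans (sub_zero _)
    ext p
    simp only [badCubes, this]
  have hfinal := H₃ q hqc τ (ρ₁ * τ) (by positivity) ?_
  · rw [hqbad] at hfinal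
    rwa [show (1 + 2 ^ k * ρ₁) * τ = τ + 2 ^ k * (ρ₁ * τ) by ring]
  -- If fewer than half of the small cubes at `x` are bad, some cube is good and also predicts near
  -- `φ x`, so `g x` is close to `P x`. Markov's inequality bounds the remaining points.
  · have hsub : {x : EuclideanSpace ℝ (Fin n) | ‖x‖ ≤ θ ∧ ρ₁ * τ < chord (q x)} ⊆
        {x | volume D / 2 ≤ volume {h | (x, h) ∈ badCubes k g τ}} := by
      rintro x ⟨hx, hlt⟩
      by_contra hfew
      simp only [Set.mem_ofPred_eq, not_le] at hfew
      obtain ⟨h, hhD, hh⟩ : ∃ h ∈ D, h ∉ {h | (x, h) ∈ badCubes k g τ} ∪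
          {h | h ∈ D ∧ k * τ < chord (vertexValue k h g x - φ x)} := by
        by_contra! hcon
        have h1 : volume D < volume D / 2 + volume D / 2 := by
          refine ((measure_mono hcon).trans (measure_union_le _ _)).trans_lt ?_
          have h2 : volume {h | h ∈ D ∧ k * τ < chord (vertexValue k h g x - φ x)} ≤
              volume D / 2 := by
            calc _ ≤ C₁ * volume (badCubes k g τ) := hφ x hx
              _ ≤ (C₁ + 1) * (volume D / 2 / (C₁ + 1)) := by gcongr; exact le_self_add
              _ = _ := ENNReal.mul_div_cancel (by simp) (by finiteness)
          exact ENNReal.add_lt_add_of_lt_of_le (ne_top_of_le_ne_top hD2top h2) hfew h2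
        rw [ENNReal.add_halves] at h1
        exact lt_irrefl _ h1
      simp only [Set.mem_union, Set.mem_ofPred_eq, not_or, not_and, not_lt] at hh
      obtain ⟨hgood, hV⟩ := hh
      have hcube : (x, h) ∈ cubeSet (Metric.ball (0 : EuclideanSpace ℝ (Fin n)) 1) k := by
        refine mem_cubeSet_ball (r := (k + 1) * r) (by positivity) hx (fun i => ?_)
          (by rw [hθb]; nlinarith) (by rw [hkr]; nlinarith)
        exact (norm_le_pi_norm _ i).trans (mem_closedBall_zero_iff.1 hhD)
      have hΔ : chord (multiDiff k h g x) ≤ τ := by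
        by_contra! hcon
        exact hgood ⟨hcube, hcon⟩
      have h1 := chord_coe_le (Φ x - MvPolynomial.eval (fun i => x i) P)
      have h2 : 2 * Real.pi * |Φ x - MvPolynomial.eval (fun i => x i) P| ≤
          2 * Real.pi * (Cw * (ε₁ * τ)) := by
        gcongr
        exact hPΦ x hx
      have h3 : q x = ((-1 : ℤ) ^ k • multiDiff k h g x + (vertexValue k h g x - φ x)) +
          ((Φ x - MvPolynomial.eval (fun i => x i) P : ℝ) : UnitAddCircle) := by
        rw [AddCircle.coe_sub, hΦφ, vertexValue, hq]
        simp only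
        abel
      have h4 := (chord_add_le ((-1 : ℤ) ^ k • multiDiff k h g x + (vertexValue k h g x - φ x))
        ((Φ x - MvPolynomial.eval (fun i => x i) P : ℝ) : UnitAddCircle)).trans
          (add_le_add_left (chord_add_le _ _) _)
      rw [← h3, chord_neg_one_pow_smul] at h4
      have h5 := hV hhD
      rw [hρ₁] at hlt
      linarith
    refine (measure_mono hsub).trans ((measure_le_measure_fiber_le volume volume
      (isOpen_badCubes k hg τ).measurableSet hD2 hD2top).trans ?_)
    rw [ENNReal.inv_mul_le_iff hD2 hD2top]
    exact hN₃

theorem MvPolynomial.exists_eval_eq_eval_mul {n : ℕ} (P : MvPolynomial (Fin n) ℝ) (c : ℝ) :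
    ∃ Q : MvPolynomial (Fin n) ℝ, Q.totalDegree ≤ P.totalDegree ∧
      ∀ x : Fin n → ℝ, MvPolynomial.eval x Q = MvPolynomial.eval (fun i => c * x i) P := by
  refine ⟨∑ m ∈ P.support, MvPolynomial.monomial m (P.coeff m * ∏ i, c ^ m i),
    MvPolynomial.totalDegree_finsetSum_le fun m hm => ?_, fun x => ?_⟩
  · exact (MvPolynomial.totalDegree_monomial_le _ _).trans (MvPolynomial.le_totalDegree hm)
  · rw [map_sum, MvPolynomial.eval_eq']
    refine Finset.sum_congr rfl fun m _ => ?_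
    rw [MvPolynomial.eval_monomial, Finsupp.prod_fintype _ _ fun _ => pow_zero _, mul_assoc,
      ← Finset.prod_mul_distrib]
    simp only [mul_pow]

theorem chord_sub_coe (θ : UnitAddCircle) (t : ℝ) :
    chord (θ - (t : UnitAddCircle)) =
      ‖expCircle θ * Complex.exp (-(2 * Real.pi * Complex.I * t)) - 1‖ := by
  rw [chord, sub_eq_add_neg θ, expCircle_add, ← AddCircle.coe_neg, expCircle_coe]
  congr 4
  push_cast
  ring

/-! ### Continuous approximation of measurable functions. -/

section Approximation

variable {E : Type*} [NormedAddCommGroup E] [NormedSpace ℝ E] [FiniteDimensional ℝ E]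
  [MeasureSpace E] [BorelSpace E] [SecondCountableTopology E]
  [(volume : Measure E).IsAddHaarMeasure]

/-- A measurable function to the circle is close to a continuous one outside a small set. -/
theorem exists_continuous_measure_chord_le {ψ : E → UnitAddCircle}
    (hψ : NullMeasurable ψ (volume.restrict (Metric.ball 0 1))) {τ : ℝ} (hτ : 0 < τ)
    {ζ : ℝ≥0∞} (hζ : ζ ≠ 0) :
    ∃ g : E → UnitAddCircle, Continuous g ∧
      volume {x : E | x ∈ Metric.ball 0 1 ∧ τ < chord (ψ x - g x)} ≤ ζ := by
  have hfin : IsFiniteMeasure ((volume : Measure E).restrict (Metric.ball 0 1)) :=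
    isFiniteMeasure_restrict.2 measure_ball_lt_top.ne
  -- The representative in `[0, 1)` is bounded, hence integrable on the ball; it is approximated in
  -- L¹ and Markov's inequality applies at level `τ / (2π)`.
  let s : E → ℝ := fun x => (AddCircle.measurableEquivIco 1 0 (ψ x) : ℝ)
  have hs : ∀ x, ((s x : ℝ) : UnitAddCircle) = ψ x := fun x =>
    (AddCircle.measurableEquivIco 1 0).symm_apply_apply (ψ x)
  have hsm : AEMeasurable s (volume.restrict (Metric.ball 0 1)) :=
    ((measurable_subtype_coe.comp
      (AddCircle.measurableEquivIco 1 0).measurable).comp_nullMeasurable hψ).aemeasurable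
  have hsint : Integrable s (volume.restrict (Metric.ball 0 1)) := by
    refine Integrable.of_bound hsm.aestronglyMeasurable 1 (Eventually.of_forall fun x => ?_)
    have := (AddCircle.measurableEquivIco 1 0 (ψ x)).2
    rw [Real.norm_eq_abs, abs_le]
    constructor <;> simp only [s] <;> linarith [this.1, this.2]
  set c : ℝ := τ / (2 * Real.pi) with hc
  have hc0 : 0 < c := by positivity
  -- The minimum with `1` handles `ζ = ∞`.
  set ζ' : ℝ := (min ζ 1).toReal with hζ'
  have hmin : min ζ 1 ≠ ∞ := ne_top_of_le_ne_top ENNReal.one_ne_top (min_le_right _ _)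
  have hζ'0 : 0 < ζ' :=
    ENNReal.toReal_pos (lt_min (pos_iff_ne_zero.2 hζ) zero_lt_one).ne' hmin
  obtain ⟨v, hv, hvint⟩ := hsint.exists_boundedContinuous_integral_sub_le (mul_pos hc0 hζ'0)
  refine ⟨fun x => (v x : UnitAddCircle), (AddCircle.continuous_mk' 1).comp v.continuous, ?_⟩
  have hmarkov := mul_meas_ge_le_integral_of_nonneg (Eventually.of_forall fun x => norm_nonneg _)
    (hsint.sub hvint).norm c
  have hle := le_of_mul_le_mul_left (hmarkov.trans hv) hc0
  have hsub : {x : E | x ∈ Metric.ball 0 1 ∧ τ < chord (ψ x - (v x : UnitAddCircle))} ⊆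
      {x | c ≤ ‖(s - v) x‖} ∩ Metric.ball 0 1 := by
    rintro x ⟨hx, hlt⟩
    refine ⟨?_, hx⟩
    rw [← hs x, ← AddCircle.coe_sub] at hlt
    have := hlt.le.trans (chord_coe_le _)
    rw [Set.mem_ofPred_eq, hc, div_le_iff₀ (by positivity)]
    simpa [mul_comm] using this
  refine (measure_mono hsub).trans ?_
  rw [← Measure.restrict_apply' measurableSet_ball]
  refine le_trans ?_ (min_le_left ζ 1)
  rw [← ofReal_measureReal (measure_ne_top _ _), ← ENNReal.ofReal_toReal hmin]
  exact ENNReal.ofReal_le_ofReal hle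

/-- Changing a function slightly outside a small set creates few bad cubes. -/
theorem exists_measure_badCubes_le (k : ℕ) :
    ∃ C : ℝ≥0, ∀ (ψ g : E → UnitAddCircle) (τ τ' : ℝ),
      volume (badCubes k g (τ + 2 ^ k * τ')) ≤ volume (badCubes k ψ τ) +
        C * volume {x : E | x ∈ Metric.ball 0 1 ∧ τ' < chord (ψ x - g x)} := by
  classical
  let T : Finset (Fin k) → (E × (Fin k → E)) →ₗ[ℝ] E := fun A =>
    LinearMap.fst ℝ _ _ + (∑ i ∈ A, LinearMap.proj i) ∘ₗ LinearMap.snd ℝ _ _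
  have hTapp : ∀ A p, T A p = p.1 + ∑ i ∈ A, p.2 i := fun A p => by simp [T]
  have hT : ∀ A, Function.Surjective (T A) := fun A z => ⟨(z, 0), by simp [hTapp]⟩
  choose C hC using fun A => exists_measure_inter_preimage_le volume volume (T A) (hT A)
    (Metric.isBounded_closedBall (x := (0 : E × (Fin k → E))) (r := 1))
  refine ⟨∑ A, C A, fun ψ g τ τ' => ?_⟩
  set S : Set E := {x : E | x ∈ Metric.ball 0 1 ∧ τ' < chord (ψ x - g x)} with hS
  have hsub : badCubes k g (τ + 2 ^ k * τ') ⊆ badCubes k ψ τ ∪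
      ⋃ A, Metric.closedBall 0 1 ∩ {p | 0 + T A p ∈ S} := by
    rintro p ⟨hp, hlt⟩
    by_contra hcon
    simp only [Set.mem_union, Set.mem_iUnion, Set.mem_inter_iff, Set.mem_ofPred_eq, not_or,
      not_exists, not_and, hTapp, zero_add] at hcon
    obtain ⟨h1, h2⟩ := hcon
    have hball : p ∈ Metric.closedBall (0 : E × (Fin k → E)) 1 := by
      rw [mem_closedBall_zero_iff, Prod.norm_def, max_le_iff,
        pi_norm_le_iff_of_nonneg zero_le_one]
      exact ⟨(mem_ball_zero_iff.1 hp.1).le, fun i => (mem_ball_zero_iff.1 (hp.2.1 i)).le⟩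
    have h3 : chord (multiDiff k p.2 ψ p.1) ≤ τ := by
      by_contra! hcon
      exact h1 ⟨hp, hcon⟩
    have h4 : chord (multiDiff k p.2 (fun y => ψ y - g y) p.1) ≤ 2 ^ k * τ' := by
      rw [multiDiff_eq_sum]
      refine (chord_sum_le_card_mul _ _ (c := τ') fun A _ => ?_).trans_eq (by simp)
      rw [chord_neg_one_pow_smul]
      by_contra! hcon
      exact h2 A hball ⟨hp.2.2 A, hcon⟩
    have h5 : multiDiff k p.2 g p.1 =
        multiDiff k p.2 ψ p.1 - multiDiff k p.2 (fun y => ψ y - g y) p.1 := by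
      rw [multiDiff_sub, sub_sub_cancel]
    rw [h5] at hlt
    linarith [chord_sub_le (multiDiff k p.2 ψ p.1) (multiDiff k p.2 (fun y => ψ y - g y) p.1)]
  refine (measure_mono hsub).trans ((measure_union_le _ _).trans ?_)
  gcongr
  refine (measure_iUnion_fintype_le _ _).trans ((Finset.sum_le_sum fun A _ => hC A 0 S).trans_eq ?_)
  rw [← Finset.sum_mul, ENNReal.ofNNReal_finsetSum]

end Approximation

section CubeVolume

variable {E : Type*} [NormedAddCommGroup E] [NormedSpace ℝ E] [FiniteDimensional ℝ E]
  [MeasureSpace E] [SecondCountableTopology E] [(volume : Measure E).IsAddHaarMeasure]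

theorem measure_cubeSet_ball_ne_zero (k : ℕ) :
    volume (cubeSet (Metric.ball (0 : E) 1) k) ≠ 0 :=
  ((isOpen_cubeSet Metric.isOpen_ball k).measure_pos volume
    ⟨0, by simp [cubeSet]⟩).ne'

theorem measure_cubeSet_ball_ne_top (k : ℕ) :
    volume (cubeSet (Metric.ball (0 : E) 1) k) ≠ ∞ := by
  refine ne_top_of_le_ne_top (measure_closedBall_lt_top (x := (0 : E × (Fin k → E))) (r := 1)).ne
    (measure_mono fun p hp => ?_)
  rw [mem_closedBall_zero_iff, Prod.norm_def, max_le_iff, pi_norm_le_iff_of_nonneg zero_le_one]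
  exact ⟨(mem_ball_zero_iff.1 hp.1).le, fun i => (mem_ball_zero_iff.1 (hp.2.1 i)).le⟩

end CubeVolume

/-! ### The unit ball: measurable functions and all parameters. -/

/-- The theorem for the unit ball. -/
theorem exists_polynomial_near_unitBall (n k : ℕ) (hk : 1 ≤ k) :
    ∃ K : ℝ, 0 < K ∧ ∃ ρ : ℝ → ℝ, (∀ τ : ℝ, 0 < τ → 0 < ρ τ) ∧ Tendsto ρ (𝓝[>] 0) (𝓝 0) ∧
      ∀ ψ : EuclideanSpace ℝ (Fin n) → UnitAddCircle,
        NullMeasurable ψ (volume.restrict (Metric.ball 0 1)) →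
        ∀ η τ : ℝ, 0 < η → 0 < τ →
          volume (badCubes k ψ τ) < ENNReal.ofReal η *
            volume (cubeSet (Metric.ball (0 : EuclideanSpace ℝ (Fin n)) 1) k) →
          ∃ P : MvPolynomial (Fin n) ℝ, P.totalDegree ≤ k - 1 ∧
            volume {x : EuclideanSpace ℝ (Fin n) | x ∈ Metric.ball 0 1 ∧
              ρ τ < chord (ψ x - (MvPolynomial.eval (fun i => x i) P : ℝ))} <
              ENNReal.ofReal (K * η) *
                volume (Metric.ball (0 : EuclideanSpace ℝ (Fin n)) 1) := by
  obtain ⟨δ₀, τ₀, C, K₀, hδ₀, hτ₀, hC, H⟩ := exists_polynomial_near_of_continuous n k hk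
  obtain ⟨C', hC'⟩ := exists_measure_badCubes_le (E := EuclideanSpace ℝ (Fin n)) k
  set vc := volume (cubeSet (Metric.ball (0 : EuclideanSpace ℝ (Fin n)) 1) k) with hvc
  have hvc0 : vc ≠ 0 := measure_cubeSet_ball_ne_zero k
  have hvctop : vc ≠ ∞ := measure_cubeSet_ball_ne_top k
  set vb := volume (Metric.ball (0 : EuclideanSpace ℝ (Fin n)) 1) with hvb
  have hvb0 : vb ≠ 0 := (Metric.measure_ball_pos _ _ one_pos).ne'
  have hvbtop : vb ≠ ∞ := measure_ball_lt_top.ne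
  set δ := min δ₀ 1 with hδ
  have hδ0 : δ ≠ 0 := (lt_min hδ₀ zero_lt_one).ne'
  have hδtop : δ ≠ ∞ := ne_top_of_le_ne_top ENNReal.one_ne_top (min_le_right _ _)
  set K₁ : ℝ≥0∞ := K₀ * (2 * vc) / vb with hK₁
  set K₂ : ℝ≥0∞ := 2 * vc / δ with hK₂
  have hK₁top : K₁ ≠ ∞ := by
    refine ENNReal.div_ne_top (by finiteness) hvb0
  have hK₂top : K₂ ≠ ∞ := ENNReal.div_ne_top (by finiteness) hδ0
  set a : ℝ := 1 + 2 ^ k with ha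
  have ha0 : 0 < a := by positivity
  -- `K₁` comes from the continuous case and `K₂` makes large `η` trivial; the `2` pays for the
  -- approximation error and the strict inequality. The value `3` exceeds every chord, so for large
  -- `τ` the exceptional set is empty.
  refine ⟨K₁.toReal + K₂.toReal + 2, by positivity,
    fun τ => if a * τ ≤ τ₀ then (C * a + 1) * τ else 3, fun τ hτ => ?_, ?_,
    fun ψ hψ η τ hη hτ hbad => ?_⟩
  · beta_reduce
    split_ifs
    · positivity
    · norm_num
  · have hlin : Tendsto (fun τ : ℝ => (C * a + 1) * τ) (𝓝[>] 0) (𝓝 0) := by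
      have : Continuous fun τ : ℝ => (C * a + 1) * τ := by fun_prop
      have h := this.tendsto 0
      rw [mul_zero] at h
      exact h.mono_left nhdsWithin_le_nhds
    refine hlin.congr' ?_
    have hlt : ∀ᶠ τ : ℝ in 𝓝[>] 0, τ < τ₀ / a :=
      nhdsWithin_le_nhds (Iio_mem_nhds (by positivity))
    filter_upwards [hlt] with τ hτ
    rw [if_pos]
    rw [lt_div_iff₀ ha0] at hτ
    linarith
  have hη0 : ENNReal.ofReal η ≠ 0 := by simpa using hη
  have hKη : ENNReal.ofReal ((K₁.toReal + K₂.toReal + 2) * η) =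
      (K₁ + K₂ + 2) * ENNReal.ofReal η := by
    rw [ENNReal.ofReal_mul (by positivity), ENNReal.ofReal_add (by positivity) (by norm_num),
      ENNReal.ofReal_add (by positivity) (by positivity), ENNReal.ofReal_toReal hK₁top,
      ENNReal.ofReal_toReal hK₂top]
    norm_num
  rw [hKη]
  by_cases hτa : a * τ ≤ τ₀
  swap
  · refine ⟨0, by simp, ?_⟩
    beta_reduce
    rw [if_neg hτa]
    have : {x : EuclideanSpace ℝ (Fin n) | x ∈ Metric.ball 0 1 ∧
        3 < chord (ψ x - (MvPolynomial.eval (fun i => x i) (0 : MvPolynomial (Fin n) ℝ) : ℝ))} =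
          ∅ := by
      ext x
      simp only [Set.mem_ofPred_eq, Set.mem_empty_iff_false, iff_false, not_and, not_lt]
      intro _
      linarith [chord_le_two
        (ψ x - ((MvPolynomial.eval (fun i => x i) (0 : MvPolynomial (Fin n) ℝ) : ℝ) :
          UnitAddCircle))]
    rw [this, measure_empty]
    exact pos_iff_ne_zero.2 (mul_ne_zero (mul_ne_zero (by simp) hη0) hvb0)
  -- Otherwise `K₂ * η > 1`, and the whole ball is an admissible exceptional set.
  by_cases hηδ : 2 * vc * ENNReal.ofReal η ≤ δ
  swap
  · refine ⟨0, by simp, (measure_mono fun x hx => hx.1).trans_lt ?_⟩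
    rw [← hvb]
    conv_lhs => rw [← one_mul vb]
    refine ENNReal.mul_lt_mul_left hvb0 hvbtop ?_
    calc (1 : ℝ≥0∞) < 2 * vc * ENNReal.ofReal η / δ := by
          rw [ENNReal.lt_div_iff_mul_lt (Or.inl hδ0) (Or.inl hδtop), one_mul]
          exact not_le.1 hηδ
      _ = K₂ * ENNReal.ofReal η := by
          rw [hK₂, ENNReal.div_eq_inv_mul, ENNReal.div_eq_inv_mul, mul_assoc δ⁻¹]
      _ ≤ _ := by
          gcongr
          exact (le_add_self).trans le_self_add
  beta_reduce
  rw [if_pos hτa]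
  obtain ⟨g, hg, hgψ⟩ := exists_continuous_measure_chord_le hψ hτ
    (ζ := min (vc * ENNReal.ofReal η / (C' + 1)) (vb * ENNReal.ofReal η))
    (lt_min (ENNReal.div_pos (mul_ne_zero hvc0 hη0) (by simp))
      (pos_iff_ne_zero.2 (mul_ne_zero hvb0 hη0))).ne'
  have hζ₁ := hgψ.trans (min_le_left _ _)
  have hζ₂ := hgψ.trans (min_le_right _ _)
  have hNg : volume (badCubes k g (a * τ)) ≤ 2 * vc * ENNReal.ofReal η := by
    have h1 := hC' ψ g τ τ
    rw [show τ + 2 ^ k * τ = a * τ by rw [ha]; ring] at h1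
    refine h1.trans ?_
    calc _ ≤ ENNReal.ofReal η * vc + (C' + 1) * (vc * ENNReal.ofReal η / (C' + 1)) := by
          gcongr
          exact le_self_add
      _ = 2 * vc * ENNReal.ofReal η := by
          rw [ENNReal.mul_div_cancel (by simp) (by finiteness)]
          ring
  obtain ⟨P, hP, hPg⟩ := H g hg (a * τ) (by positivity) hτa
    (hNg.trans (hηδ.trans (min_le_left _ _)))
  refine ⟨P, hP, ?_⟩
  have hsub : {x : EuclideanSpace ℝ (Fin n) | x ∈ Metric.ball 0 1 ∧
      (C * a + 1) * τ < chord (ψ x - (MvPolynomial.eval (fun i => x i) P : ℝ))} ⊆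
      {x | x ∈ Metric.ball 0 1 ∧
        C * (a * τ) < chord (g x - (MvPolynomial.eval (fun i => x i) P : ℝ))} ∪
      {x | x ∈ Metric.ball 0 1 ∧ τ < chord (ψ x - g x)} := by
    rintro x ⟨hx, hlt⟩
    by_contra hcon
    simp only [Set.mem_union, Set.mem_ofPred_eq, not_or, not_and, not_lt] at hcon
    have h1 := chord_add_le (ψ x - g x) (g x - (MvPolynomial.eval (fun i => x i) P : ℝ))
    rw [sub_add_sub_cancel] at h1
    linarith [hcon.1 hx, hcon.2 hx]
  have hfin : K₁ * ENNReal.ofReal η * vb + vb * ENNReal.ofReal η ≠ ∞ := by finiteness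
  calc _ ≤ K₀ * (2 * vc * ENNReal.ofReal η) + vb * ENNReal.ofReal η := by
        refine (measure_mono hsub).trans ((measure_union_le _ _).trans ?_)
        gcongr
        exact hPg.trans (by gcongr)
    _ = K₁ * ENNReal.ofReal η * vb + vb * ENNReal.ofReal η := by
        have h1 : K₁ * vb = K₀ * (2 * vc) := ENNReal.div_mul_cancel hvb0 hvbtop
        rw [mul_right_comm K₁, h1]
        ring
    _ < K₁ * ENNReal.ofReal η * vb + vb * ENNReal.ofReal η + vb * ENNReal.ofReal η :=
        ENNReal.lt_add_right hfin (mul_ne_zero hvb0 hη0)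
    _ = (K₁ + 2) * ENNReal.ofReal η * vb := by ring
    _ ≤ _ := by
        gcongr
        exact le_self_add

/-! ### Scaling to a ball of any radius. -/

theorem quasiMeasurePreserving_smul_ball {E : Type*} [NormedAddCommGroup E] [NormedSpace ℝ E]
    [FiniteDimensional ℝ E] [MeasurableSpace E] [BorelSpace E] (μ : Measure E)
    [μ.IsAddHaarMeasure] {R : ℝ} (hR : 0 < R) :
    Measure.QuasiMeasurePreserving (fun x : E => R • x) (μ.restrict (Metric.ball 0 1))
      (μ.restrict (Metric.ball 0 R)) := by
  refine ⟨measurable_const_smul R, Measure.AbsolutelyContinuous.mk fun s hs hs0 => ?_⟩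
  rw [Measure.map_apply (measurable_const_smul R) hs, Measure.restrict_apply' measurableSet_ball]
  rw [Measure.restrict_apply' measurableSet_ball] at hs0
  have h1 : (fun x : E => R • x) ⁻¹' s ∩ Metric.ball 0 1 ⊆
      (fun x : E => R • x) ⁻¹' (s ∩ Metric.ball 0 R) := by
    rintro x ⟨hx, hx1⟩
    refine ⟨hx, ?_⟩
    rw [mem_ball_zero_iff] at hx1 ⊢
    rw [norm_smul, Real.norm_of_nonneg hR.le]
    nlinarith
  refine measure_mono_null h1 ?_
  rw [Measure.addHaar_preimage_smul μ hR.ne', hs0, mul_zero]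

theorem preimage_smul_cubeSet_ball {E : Type*} [NormedAddCommGroup E] [NormedSpace ℝ E] {R : ℝ}
    (hR : 0 < R) (k : ℕ) :
    (fun p : E × (Fin k → E) => R • p) ⁻¹' cubeSet (Metric.ball (0 : E) R) k =
      cubeSet (Metric.ball (0 : E) 1) k := by
  have h : ∀ x : E, R • x ∈ Metric.ball (0 : E) R ↔ x ∈ Metric.ball (0 : E) 1 := fun x => by
    rw [mem_ball_zero_iff, mem_ball_zero_iff, norm_smul, Real.norm_of_nonneg hR.le]
    exact ⟨fun h => by nlinarith, fun h => by nlinarith⟩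
  ext p
  simp only [cubeSet, Set.mem_preimage, Set.mem_ofPred_eq, Prod.smul_fst, Prod.smul_snd,
    Pi.smul_apply, ← Finset.smul_sum, ← smul_add, h]

/-- The dilation by `R` multiplies both sides of each measure inequality by the same factor, so `K`
and `ρ` do not depend on `R`. Lebesgue measurability on the ball is null-measurability for the
restricted volume; the values of `ψ` outside the ball play no role. -/
theorem theorem10p1 (n k : ℕ) (hn : 1 ≤ n) (hk : 1 ≤ k) :
    ∃ K : ℝ, 0 < K ∧ ∃ ρ : ℝ → ℝ, (∀ τ : ℝ, 0 < τ → 0 < ρ τ) ∧ Tendsto ρ (𝓝[>] 0) (𝓝 0) ∧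
      ∀ R : ℝ, 0 < R → ∀ ψ : EuclideanSpace ℝ (Fin n) → UnitAddCircle,
        NullMeasurable ψ (volume.restrict (Metric.ball 0 R)) →
        ∀ η τ : ℝ, 0 < η → 0 < τ →
          volume {p ∈ cubeSet (Metric.ball (0 : EuclideanSpace ℝ (Fin n)) R) k |
              τ < ‖expCircle (multiDiff k p.2 ψ p.1) - 1‖} <
            ENNReal.ofReal η *
              volume (cubeSet (Metric.ball (0 : EuclideanSpace ℝ (Fin n)) R) k) →
          ∃ P : MvPolynomial (Fin n) ℝ, P.totalDegree ≤ k - 1 ∧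
            volume {x ∈ Metric.ball (0 : EuclideanSpace ℝ (Fin n)) R |
                ρ τ < ‖expCircle (ψ x) * Complex.exp (-(2 * Real.pi * Complex.I *
                  (MvPolynomial.eval (fun i => x i) P : ℝ))) - 1‖} <
              ENNReal.ofReal (K * η) *
                volume (Metric.ball (0 : EuclideanSpace ℝ (Fin n)) R) := by
  obtain ⟨K, hK, ρ, hρ, hρ0, H⟩ := exists_polynomial_near_unitBall n k hk
  refine ⟨K, hK, ρ, hρ, hρ0, fun R hR ψ hψ η τ hη hτ hbad => ?_⟩
  have hcoef : ∀ d : ℕ, ENNReal.ofReal |(R ^ d)⁻¹| ≠ 0 := fun d => by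
    simp only [ne_eq, ENNReal.ofReal_eq_zero, not_le]
    positivity
  have hbad' : volume (badCubes k (fun x => ψ (R • x)) τ) < ENNReal.ofReal η *
      volume (cubeSet (Metric.ball (0 : EuclideanSpace ℝ (Fin n)) 1) k) := by
    have h1 : badCubes k (fun x => ψ (R • x)) τ =
        (fun p : EuclideanSpace ℝ (Fin n) × (Fin k → EuclideanSpace ℝ (Fin n)) => R • p) ⁻¹'
          {p ∈ cubeSet (Metric.ball (0 : EuclideanSpace ℝ (Fin n)) R) k |
              τ < ‖expCircle (multiDiff k p.2 ψ p.1) - 1‖} := by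
      rw [badCubes, ← preimage_smul_cubeSet_ball hR]
      ext p
      have h2 := multiDiff_comp_hom (DistribSMul.toAddMonoidHom (EuclideanSpace ℝ (Fin n)) R) k
        p.2 ψ p.1
      simp only [DistribSMul.toAddMonoidHom_apply] at h2
      simp only [Set.mem_ofPred_eq, Set.mem_preimage, h2, chord]
      rfl
    have : (volume : Measure (EuclideanSpace ℝ (Fin n) ×
        (Fin k → EuclideanSpace ℝ (Fin n)))).IsAddHaarMeasure := isAddHaarMeasure_volume_prod
    rw [h1, ← preimage_smul_cubeSet_ball hR, Measure.addHaar_preimage_smul _ hR.ne',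
      Measure.addHaar_preimage_smul _ hR.ne', mul_left_comm]
    exact ENNReal.mul_lt_mul_right (hcoef _) ENNReal.ofReal_ne_top hbad
  obtain ⟨P, hP, hPψ⟩ := H (fun x => ψ (R • x))
    (hψ.comp_quasiMeasurePreserving (quasiMeasurePreserving_smul_ball volume hR)) η τ hη hτ hbad'
  obtain ⟨Q, hQ, hQP⟩ := P.exists_eval_eq_eval_mul R⁻¹
  refine ⟨Q, hQ.trans hP, ?_⟩
  have hball : (fun x : EuclideanSpace ℝ (Fin n) => R • x) ⁻¹' Metric.ball 0 R =
      Metric.ball 0 1 := by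
    ext x
    rw [Set.mem_preimage, mem_ball_zero_iff, mem_ball_zero_iff, norm_smul,
      Real.norm_of_nonneg hR.le]
    exact ⟨fun h => by nlinarith, fun h => by nlinarith⟩
  have hset : {x : EuclideanSpace ℝ (Fin n) | x ∈ Metric.ball 0 1 ∧
      ρ τ < chord (ψ (R • x) - (MvPolynomial.eval (fun i => x i) P : ℝ))} =
      (fun x : EuclideanSpace ℝ (Fin n) => R • x) ⁻¹'
        {x ∈ Metric.ball (0 : EuclideanSpace ℝ (Fin n)) R |
                ρ τ < ‖expCircle (ψ x) * Complex.exp (-(2 * Real.pi * Complex.I *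
                  (MvPolynomial.eval (fun i => x i) Q : ℝ))) - 1‖} := by
    rw [← hball]
    ext x
    simp only [Set.mem_ofPred_eq, Set.mem_preimage, ← chord_sub_coe, hQP, PiLp.smul_apply,
      smul_eq_mul, inv_mul_cancel_left₀ hR.ne']
  rw [hset, ← hball, Measure.addHaar_preimage_smul _ hR.ne',
    Measure.addHaar_preimage_smul _ hR.ne', mul_left_comm] at hPψ
  exact (ENNReal.mul_lt_mul_iff_right (hcoef _) ENNReal.ofReal_ne_top).1 hPψ
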